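/- Let $(X,\mu)$ be a probability space and let $G$ be a locally compact Hausdorff topological group. All $L^p$-spaces are real. Let $1\le p_0<\infty$, and let $\rho^{p_0}$ be a strongly continuous representation of $G$ on $L^{p_0}(X,\mu)$ by isometric lattice automorphisms that leave the constants fixed. Then there is a unique family $(\rho^p)_{1\le p<\infty}$ of strongly continuous representations $\rho^p$ of $G$ on $L^p(X,\mu)$ by isometric lattice automorphisms that leave the constants fixed, which contains the given $\rho^{p_0}$ and is compatible with the inclusions, i.e. $\rho^p(g)f=\rho^q(g)f$ for all $g\in G$, $1\le p\le q<\infty$ and $f\in L^q(X,\mu)\subseteq L^p(X,\mu)$. For this family there exist 1. a compact Hausdorff space $K$ and an action of $G$ on $K$ such that $(g,x)\mapsto gx$ is continuous from $G\times K$ to $K$; 2. a $G$-invariant regular Borel probability measure $\widetilde\mu$ on $K$ with $\operatorname{supp}\widetilde\mu=K$; 3. surjective linear isometries $\Phi_p:L^p(X,\mu)\to L^p(K,\widetilde\mu)$ ($1\le p<\infty$) that preserve the lattice operations and are such that (a) $\Phi_p(\mathbf 1_X)=\mathbf 1_K$ for all $p$; (b) $\Phi_p f=\Phi_q f$ for all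 $1\le p\le q<\infty$ and $f\in L^q(X,\mu)$, where $L^q\subseteq L^p$ on both sides; (c) $\Phi_p\circ\rho^p(g)=\widetilde\rho^{\,p}(g)\circ\Phi_p$ for all $g\in G$ and all $p$, where $\widetilde\rho^{\,p}(g)[f]=[x\mapsto f(g^{-1}x)]$ is the canonical representation of $G$ on $L^p(K,\widetilde\mu)$, which is a strongly continuous representation by isometric lattice automorphisms that leave the constants fixed. If $\mu$ is separable (i.e. there is a countable family of measurable sets such that every measurable set can be approximated by members $B$ of it, in the sense that $\mu(A\mathbin{\Delta}B)$ can be made arbitrarily small) and $G$ is $\sigma$-compact, then $K$ can be taken to be metrizable. -/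

import Mathlib

open MeasureTheory
open scoped ENNReal

universe u v

noncomputable section

/-- The exponents `p` with `1 ≤ p < ∞`. -/
abbrev FiniteExponent : Type := {p : ℝ≥0∞ // 1 ≤ p ∧ p ≠ ∞}

instance FiniteExponent.fact_one_le (p : FiniteExponent) : Fact (1 ≤ (p : ℝ≥0∞)) := ⟨p.2.1⟩

/-- For a finite measure and `p ≤ q`, the inclusion of `L^q` in `L^p` (the same a.e. class of
functions, seen in the larger space). -/
def lpInclusion {X : Type*} [MeasurableSpace X] (μ : Measure X) [IsFiniteMeasure μ]
    {p q : ℝ≥0∞} (hpq : p ≤ q) : Lp ℝ q μ →+ Lp ℝ p μ :=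
  AddSubgroup.inclusion (Lp.antitone hpq)

/-- `T` preserves the lattice operations (pointwise a.e. maximum and minimum). -/
structure PreservesLattice {X Y : Type*} [MeasurableSpace X] [MeasurableSpace Y]
    {μ : Measure X} {ν : Measure Y} {p q : ℝ≥0∞} (T : Lp ℝ p μ → Lp ℝ q ν) : Prop where
  map_sup : ∀ f h : Lp ℝ p μ, T (f ⊔ h) = T f ⊔ T h
  map_inf : ∀ f h : Lp ℝ p μ, T (f ⊓ h) = T f ⊓ T h

/-- A strongly continuous representation of `G` on `L^p(X, μ)` by isometric lattice automorphisms
that leave the constants fixed. That each `ρ g` is a bijective linear isometry, and that `ρ` is a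
group homomorphism, is in the type of `ρ`. -/
structure IsStronglyContinuousLatticeRep {G X : Type*} [Group G] [TopologicalSpace G]
    [MeasurableSpace X] {μ : Measure X} [IsFiniteMeasure μ] {p : ℝ≥0∞} [Fact (1 ≤ p)]
    (ρ : G →* (Lp ℝ p μ ≃ₗᵢ[ℝ] Lp ℝ p μ)) : Prop where
  lattice : ∀ g : G, PreservesLattice (ρ g)
  fixes_const : ∀ (g : G) (c : ℝ), ρ g (Lp.const p μ c) = Lp.const p μ c
  continuous : ∀ f : Lp ℝ p μ, Continuous fun g : G => ρ g f

/-- `ρ` is a family of strongly continuous representations of `G` on all the spaces `L^p(X, μ)`,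
`1 ≤ p < ∞`, by isometric lattice automorphisms that leave the constants fixed, which contains the
representation `ρ₀` on `L^{p₀}(X, μ)` and is compatible with the inclusions `L^q ⊆ L^p`, `p ≤ q`. -/
structure IsNaturalFamily {G X : Type*} [Group G] [TopologicalSpace G]
    [MeasurableSpace X] {μ : Measure X} [IsFiniteMeasure μ] {p₀ : FiniteExponent}
    (ρ₀ : G →* (Lp ℝ (p₀ : ℝ≥0∞) μ ≃ₗᵢ[ℝ] Lp ℝ (p₀ : ℝ≥0∞) μ))
    (ρ : ∀ p : FiniteExponent, G →* (Lp ℝ (p : ℝ≥0∞) μ ≃ₗᵢ[ℝ] Lp ℝ (p : ℝ≥0∞) μ)) : Prop where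
  base : ρ p₀ = ρ₀
  rep : ∀ p : FiniteExponent, IsStronglyContinuousLatticeRep (ρ p)
  compatible : ∀ (p q : FiniteExponent) (hpq : (p : ℝ≥0∞) ≤ q) (g : G) (f : Lp ℝ (q : ℝ≥0∞) μ),
    ρ p g (lpInclusion μ hpq f) = lpInclusion μ hpq (ρ q g f)

section Canonical

variable {G K : Type*} [Group G] [MulAction G K] [MeasurableSpace K] [MeasurableConstSMul G K]
  (ν : Measure K) [SMulInvariantMeasure G K ν] (p : ℝ≥0∞) [Fact (1 ≤ p)]

/-- The operator `[f] ↦ [x ↦ f (g⁻¹ x)]` on `L^p(K, ν)`, for an invariant measure `ν`. -/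
def canonicalOp (g : G) : Lp ℝ p ν →ₗᵢ[ℝ] Lp ℝ p ν :=
  Lp.compMeasurePreservingₗᵢ ℝ (fun x : K => g⁻¹ • x) (measurePreserving_smul g⁻¹ ν)

theorem canonicalOp_ae (g : G) (f : Lp ℝ p ν) :
    canonicalOp ν p g f =ᵐ[ν] fun x => f (g⁻¹ • x) :=
  Lp.coeFn_compMeasurePreserving f (measurePreserving_smul g⁻¹ ν)

theorem canonicalOp_one (f : Lp ℝ p ν) : canonicalOp ν p (1 : G) f = f := by
  refine Lp.ext ((canonicalOp_ae ν p (1 : G) f).trans ?_)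
  simp

theorem canonicalOp_mul (g h : G) (f : Lp ℝ p ν) :
    canonicalOp ν p (g * h) f = canonicalOp ν p g (canonicalOp ν p h f) := by
  refine Lp.ext ((canonicalOp_ae ν p (g * h) f).trans ?_)
  refine Filter.EventuallyEq.trans ?_ (canonicalOp_ae ν p g _).symm
  have h1 := (measurePreserving_smul g⁻¹ ν).quasiMeasurePreserving.ae_eq_comp
    (canonicalOp_ae ν p h f)
  filter_upwards [h1] with x hx
  simp only [Function.comp_apply] at hx
  rw [hx, mul_inv_rev, mul_smul]

/-- The canonical (Koopman) representation `g ↦ ([f] ↦ [x ↦ f (g⁻¹ x)])` of `G` on `L^p(K, ν)`,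
for a measure `ν` that is invariant under the action of `G` on `K`. -/
def canonicalRep : G →* (Lp ℝ p ν ≃ₗᵢ[ℝ] Lp ℝ p ν) where
  toFun g :=
    { toLinearEquiv := LinearEquiv.ofLinearMap (canonicalOp ν p g).toLinearMap
        (canonicalOp ν p g⁻¹).toLinearMap
        (by ext1 f; simpa [canonicalOp_one] using (canonicalOp_mul ν p g g⁻¹ f).symm)
        (by ext1 f; simpa [canonicalOp_one] using (canonicalOp_mul ν p g⁻¹ g f).symm)
      norm_map' := fun f => (canonicalOp ν p g).norm_map f }
  map_one' := by ext1 f; exact canonicalOp_one ν p f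
  map_mul' g h := by ext1 f; exact canonicalOp_mul ν p g h f

theorem canonicalRep_ae (g : G) (f : Lp ℝ p ν) :
    canonicalRep ν p g f =ᵐ[ν] fun x => f (g⁻¹ • x) :=
  canonicalOp_ae ν p g f

end Canonical

end

/-!
The proof works on `L^1(μ)` throughout and descends to the other `L^p`-spaces by restriction. The
reason this is possible is that a bijective linear isometry `T` between `L^p`-spaces of probability
spaces that preserves the lattice operations and the constants preserves distributions
(`IsUnitalLatticeMap.identDistrib`): the indicator of `{c < f}` is the limit of the elements
`(n (f - c)⁺) ∧ 1`, which `T` maps to the corresponding elements for `T f`. So `T` preserves all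
`L^q`-norms, hence extends to `L^1` by density and restricts from `L^1` to every `L^q`. This gives
the natural family and its uniqueness; strong continuity passes to `L^p` because on bounded
functions the `L^p`-norm is controlled by the `L^1`-norm.

For the topological model, consider the bounded functions whose orbit maps are continuous for the
norm of `L^∞` (`uniformlyContinuousVectors`). They form an invariant linear sublattice `B` of `L^1`
that contains the constants, and it is dense since it contains the averages `∫ φ(g) σ(g) f dg` with
respect to Haar measure, `φ ∈ C_c(G)`, of bounded functions `f`. Take for `K` the set of unital
lattice homomorphisms `B → ℝ` with the topology of pointwise convergence. It is compact, and it has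
enough points: limits along ultrafilters finer than the filter of conull sets are such
homomorphisms (`nonneg_of_forall_latticeCharacter_nonneg`). By the Stone–Weierstrass theorem for
lattices `B` is dense in `C(K)`, so that integration on `B` extends to a positive functional on
`C(K)`, which the Riesz–Markov–Kakutani theorem represents by a measure `ν`. The map `B → C(K)` is
isometric for the `L^1`-norms and extends to an isomorphism `L^1(μ) → L^1(ν)`, which again restricts
to all `L^p`. The group acts on `K` by `(g • x) f = x (σ(g⁻¹) f)`, and joint continuity of this
action is the `L^∞`-continuity of the orbits of elements of `B`.

If `μ` is separable and `G` is `σ`-compact, replace `B` by the sublattice generated by the orbits of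
a countable set that is dense in `L^1`. Each of these orbits is separable in the norm of `L^∞`, so
that countably many functions separate the points of `K`.
-/

noncomputable section

open Filter Topology

/-! ### Unital lattice homomorphisms and inclusions of `L^p`-spaces -/

/-- A map between `L^p`-spaces that preserves the lattice operations and maps each constant
function to the same constant. -/
structure IsUnitalLatticeMap {X Y : Type*} [MeasurableSpace X] [MeasurableSpace Y]
    {μ : Measure X} {ν : Measure Y} [IsFiniteMeasure μ] [IsFiniteMeasure ν] {p : ℝ≥0∞}
    (T : Lp ℝ p μ → Lp ℝ p ν) : Prop extends PreservesLattice T where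
  map_const : ∀ c : ℝ, T (Lp.const p μ c) = Lp.const p ν c

section Inclusion

variable {X : Type*} [MeasurableSpace X] {μ : Measure X}

instance Lp.isOrderedModule_real {p : ℝ≥0∞} : IsOrderedModule ℝ (Lp ℝ p μ) where
  smul_le_smul_of_nonneg_left a ha f h hfh := by
    rw [← Lp.coeFn_le] at hfh ⊢
    filter_upwards [hfh, Lp.coeFn_smul a f, Lp.coeFn_smul a h] with x hx h1 h2
    simpa [h1, h2] using mul_le_mul_of_nonneg_left hx ha
  smul_le_smul_of_nonneg_right f hf a b hab := by
    rw [← Lp.coeFn_le]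
    rw [← Lp.coeFn_nonneg] at hf
    filter_upwards [hf, Lp.coeFn_smul a f, Lp.coeFn_smul b f] with x hx h1 h2
    simpa [h1, h2] using mul_le_mul_of_nonneg_right hab hx

theorem Lp.const_eq_smul [IsFiniteMeasure μ] (p : ℝ≥0∞) (c : ℝ) :
    Lp.const p μ c = c • Lp.const p μ (1 : ℝ) := by
  refine Lp.ext ?_
  filter_upwards [Lp.coeFn_smul c (Lp.const p μ (1 : ℝ)), Lp.coeFn_const p μ c,
    Lp.coeFn_const p μ (1 : ℝ)] with x h1 h2 h3
  rw [h1, h2, Pi.smul_apply, h3, Function.const_apply, Function.const_apply, smul_eq_mul, mul_one]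

theorem Lp.const_le_const [IsFiniteMeasure μ] (p : ℝ≥0∞) {a b : ℝ} (hab : a ≤ b) :
    Lp.const p μ a ≤ Lp.const p μ b := by
  rw [← Lp.coeFn_le]
  filter_upwards [Lp.coeFn_const p μ a, Lp.coeFn_const p μ b] with x h1 h2
  rwa [h1, h2]

variable [IsFiniteMeasure μ] {p q : ℝ≥0∞}

theorem coeFn_lpInclusion (hpq : p ≤ q) (f : Lp ℝ q μ) : ⇑(lpInclusion μ hpq f) = f := rfl

theorem lpInclusion_injective (hpq : p ≤ q) : Function.Injective (lpInclusion μ hpq) := by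
  intro f h hfh
  refine Lp.ext ?_
  rw [← coeFn_lpInclusion hpq f, ← coeFn_lpInclusion hpq h, hfh]

theorem lpInclusion_sup (hpq : p ≤ q) (f h : Lp ℝ q μ) :
    lpInclusion μ hpq (f ⊔ h) = lpInclusion μ hpq f ⊔ lpInclusion μ hpq h := rfl

theorem lpInclusion_inf (hpq : p ≤ q) (f h : Lp ℝ q μ) :
    lpInclusion μ hpq (f ⊓ h) = lpInclusion μ hpq f ⊓ lpInclusion μ hpq h := rfl

theorem lpInclusion_const (hpq : p ≤ q) (c : ℝ) :
    lpInclusion μ hpq (Lp.const q μ c) = Lp.const p μ c := rfl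

theorem lpInclusion_smul (hpq : p ≤ q) (c : ℝ) (f : Lp ℝ q μ) :
    lpInclusion μ hpq (c • f) = c • lpInclusion μ hpq f := rfl

/-- The inclusion of `L^q` in `L^p` as a linear map. -/
def lpInclusionₗ (μ : Measure X) [IsFiniteMeasure μ] (hpq : p ≤ q) : Lp ℝ q μ →ₗ[ℝ] Lp ℝ p μ where
  toFun := lpInclusion μ hpq
  map_add' := map_add _
  map_smul' := lpInclusion_smul hpq

theorem norm_lpInclusion_le {μ : Measure X} [IsProbabilityMeasure μ] (hpq : p ≤ q)
    (f : Lp ℝ q μ) : ‖lpInclusion μ hpq f‖ ≤ ‖f‖ := by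
  rw [Lp.norm_def, Lp.norm_def, coeFn_lpInclusion]
  exact ENNReal.toReal_mono (Lp.eLpNorm_ne_top f)
    (eLpNorm_le_eLpNorm_of_exponent_le hpq (Lp.aestronglyMeasurable f))

theorem continuous_lpInclusion {μ : Measure X} [IsProbabilityMeasure μ] [Fact (1 ≤ p)]
    [Fact (1 ≤ q)] (hpq : p ≤ q) : Continuous (lpInclusion μ hpq) :=
  AddMonoidHomClass.continuous_of_bound (lpInclusion μ hpq) 1
    fun f => by simpa using norm_lpInclusion_le hpq f

/-- The absolute value of `f` is bounded by a constant, that is, `f ∈ L^∞`. -/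
def Lp.IsBounded (f : Lp ℝ p μ) : Prop := ∃ c : ℝ, |f| ≤ Lp.const p μ c

theorem Lp.abs_le_const_iff {f : Lp ℝ p μ} {c : ℝ} :
    |f| ≤ Lp.const p μ c ↔ ∀ᵐ x ∂μ, |f x| ≤ c := by
  rw [← Lp.coeFn_le]
  constructor <;> intro h
  · filter_upwards [h, Lp.coeFn_abs f, Lp.coeFn_const p μ c] with x h1 h2 h3
    rwa [h2, h3] at h1
  · filter_upwards [h, Lp.coeFn_abs f, Lp.coeFn_const p μ c] with x h1 h2 h3
    rwa [h2, h3]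

theorem Lp.dense_isBounded [Fact (1 ≤ p)] (hp : p ≠ ∞) :
    Dense {f : Lp ℝ p μ | Lp.IsBounded f} := by
  refine (Lp.simpleFunc.dense hp).mono ?_
  rintro f ⟨g, hg⟩
  obtain ⟨c, hc⟩ := g.exists_forall_norm_le
  refine ⟨c, Lp.abs_le_const_iff.2 ?_⟩
  have hfg : ⇑f =ᵐ[μ] g := hg ▸ AEEqFun.coeFn_mk _ _
  filter_upwards [hfg] with x hx
  rw [hx]
  exact hc x

theorem Lp.IsBounded.exists_lpInclusion (hpq : p ≤ q) {f : Lp ℝ p μ} (hf : Lp.IsBounded f) :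
    ∃ f' : Lp ℝ q μ, lpInclusion μ hpq f' = f := by
  obtain ⟨c, hc⟩ := hf
  have h := MemLp.of_bound (p := q) (Lp.aestronglyMeasurable f) c (Lp.abs_le_const_iff.1 hc)
  refine ⟨h.toLp, Lp.ext ?_⟩
  rw [coeFn_lpInclusion]
  exact h.coeFn_toLp

theorem denseRange_lpInclusion [Fact (1 ≤ p)] (hp : p ≠ ∞) (hpq : p ≤ q) :
    DenseRange (lpInclusion μ hpq) :=
  (Lp.dense_isBounded hp).mono fun _ hf => hf.exists_lpInclusion hpq

end Inclusion

/-! ### Unital lattice isometries preserve distributions -/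

section Distribution

variable {X Y : Type*} [MeasurableSpace X] [MeasurableSpace Y] {μ : Measure X} {ν : Measure Y}
  [IsProbabilityMeasure μ] [IsProbabilityMeasure ν] {p : ℝ≥0∞}

/-- The indicator of `{c < f}` is the increasing limit of the functions `(n (f - c)⁺) ∧ 1`, which
are obtained from `f` and constants by lattice and vector space operations. -/
theorem tendsto_eLpNorm_rpow_superlevel (hp0 : p ≠ 0) (hp : p ≠ ∞) (f : Lp ℝ p μ) (c : ℝ) :
    Tendsto (fun n : ℕ => eLpNorm (((n : ℝ) • (f - Lp.const p μ c) ⊔ Lp.const p μ 0) ⊓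
      Lp.const p μ 1 : Lp ℝ p μ) p μ ^ p.toReal) atTop (𝓝 (μ {x | c < f x})) := by
  have hpp : 0 < p.toReal := ENNReal.toReal_pos hp0 hp
  have hae : ∀ n : ℕ, (fun x => ‖(((n : ℝ) • (f - Lp.const p μ c) ⊔ Lp.const p μ 0) ⊓
      Lp.const p μ 1 : Lp ℝ p μ) x‖ₑ ^ p.toReal) =ᵐ[μ]
      fun x => ENNReal.ofReal (min (max (n * (f x - c)) 0) 1) ^ p.toReal := by
    intro n
    filter_upwards [Lp.coeFn_inf ((n : ℝ) • (f - Lp.const p μ c) ⊔ Lp.const p μ 0)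
      (Lp.const p μ 1), Lp.coeFn_sup ((n : ℝ) • (f - Lp.const p μ c)) (Lp.const p μ 0),
      Lp.coeFn_smul (n : ℝ) (f - Lp.const p μ c), Lp.coeFn_sub f (Lp.const p μ c),
      Lp.coeFn_const p μ c, Lp.coeFn_const p μ (0 : ℝ), Lp.coeFn_const p μ (1 : ℝ)]
      with x h1 h2 h3 h4 h5 h6 h7
    rw [h1, Pi.inf_apply, h2, Pi.sup_apply, h3, Pi.smul_apply, h4, Pi.sub_apply, h5, h6, h7]
    simp only [Function.const_apply, smul_eq_mul]
    rw [Real.enorm_of_nonneg (le_min (le_max_right _ _) zero_le_one)]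
  have hnorm : ∀ n : ℕ, eLpNorm (((n : ℝ) • (f - Lp.const p μ c) ⊔ Lp.const p μ 0) ⊓
      Lp.const p μ 1 : Lp ℝ p μ) p μ ^ p.toReal =
      ∫⁻ x, ENNReal.ofReal (min (max (n * (f x - c)) 0) 1) ^ p.toReal ∂μ := by
    intro n
    rw [eLpNorm_eq_lintegral_rpow_enorm_toReal hp0 hp, ← ENNReal.rpow_mul,
      one_div_mul_cancel hpp.ne', ENNReal.rpow_one]
    exact lintegral_congr_ae (hae n)
  simp_rw [hnorm]
  have hfm := (Lp.aestronglyMeasurable f).aemeasurable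
  have hset : μ {x | c < f x} = ∫⁻ x, {x | c < f x}.indicator 1 x ∂μ := by
    rw [lintegral_indicator_one₀]
    exact nullMeasurableSet_lt aemeasurable_const hfm
  rw [hset]
  refine lintegral_tendsto_of_tendsto_of_monotone (fun n => ?_) (ae_of_all _ fun x => ?_)
    (ae_of_all _ fun x => ?_)
  · fun_prop
  · intro m n hmn
    dsimp only
    gcongr ENNReal.ofReal ?_ ^ _
    rcases le_total 0 (f x - c) with h | h
    · gcongr
    · rw [max_eq_right (mul_nonpos_of_nonneg_of_nonpos (Nat.cast_nonneg _) h)]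
      exact min_le_min (le_max_right _ _) le_rfl
  · by_cases hx : c < f x
    · rw [Set.indicator_of_mem (by exact hx)]
      refine tendsto_const_nhds.congr' ?_
      obtain ⟨N, hN⟩ := exists_nat_ge (f x - c)⁻¹
      filter_upwards [eventually_ge_atTop N] with n hn
      have hpos : 0 < f x - c := sub_pos.2 hx
      have : 1 ≤ n * (f x - c) := by
        rw [← div_le_iff₀ hpos, one_div]
        exact hN.trans (by exact_mod_cast hn)
      rw [min_eq_right (this.trans (le_max_left _ _))]
      simp
    · rw [Set.indicator_of_notMem (by exact hx)]
      refine tendsto_const_nhds.congr fun n => ?_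
      have : n * (f x - c) ≤ 0 :=
        mul_nonpos_of_nonneg_of_nonpos (Nat.cast_nonneg _) (sub_nonpos.2 (not_lt.1 hx))
      rw [max_eq_right this]
      simp [hpp]

variable [Fact (1 ≤ p)]

/-- A unital lattice isometry preserves distributions: it maps `(n (f - c)⁺) ∧ 1` to
`(n (T f - c)⁺) ∧ 1`, so that the superlevel sets of `f` and `T f` have the same measure. -/
theorem IsUnitalLatticeMap.identDistrib {T : Lp ℝ p μ ≃ₗᵢ[ℝ] Lp ℝ p ν}
    (hT : IsUnitalLatticeMap T) (hp : p ≠ ∞) (f : Lp ℝ p μ) :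
    ProbabilityTheory.IdentDistrib (T f) f ν μ := by
  have hp0 : p ≠ 0 := (zero_lt_one.trans_le (Fact.out : 1 ≤ p)).ne'
  have hlevel : ∀ c : ℝ, ν {x | c < T f x} = μ {x | c < f x} := by
    intro c
    refine tendsto_nhds_unique (tendsto_eLpNorm_rpow_superlevel hp0 hp (T f) c) ?_
    refine (tendsto_eLpNorm_rpow_superlevel hp0 hp f c).congr fun n => ?_
    rw [← Lp.enorm_def, ← Lp.enorm_def]
    have : T (((n : ℝ) • (f - Lp.const p μ c) ⊔ Lp.const p μ 0) ⊓ Lp.const p μ 1) =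
        ((n : ℝ) • (T f - Lp.const p ν c) ⊔ Lp.const p ν 0) ⊓ Lp.const p ν 1 := by
      rw [hT.map_inf, hT.map_sup, map_smul, map_sub, hT.map_const, hT.map_const, hT.map_const]
    rw [← this, T.enorm_map]
  have hfm := (Lp.aestronglyMeasurable f).aemeasurable
  have hTm := (Lp.aestronglyMeasurable (T f)).aemeasurable
  refine ⟨hTm, hfm, ?_⟩
  have := Measure.isProbabilityMeasure_map hfm
  have := Measure.isProbabilityMeasure_map hTm
  refine Measure.ext_of_Iic _ _ fun c => ?_
  rw [← Set.compl_Ioi, prob_compl_eq_one_sub measurableSet_Ioi,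
    prob_compl_eq_one_sub measurableSet_Ioi,
    Measure.map_apply_of_aemeasurable hTm measurableSet_Ioi,
    Measure.map_apply_of_aemeasurable hfm measurableSet_Ioi]
  exact congrArg _ (hlevel c)

theorem IsUnitalLatticeMap.eLpNorm_eq {T : Lp ℝ p μ ≃ₗᵢ[ℝ] Lp ℝ p ν}
    (hT : IsUnitalLatticeMap T) (hp : p ≠ ∞) (q : ℝ≥0∞) (f : Lp ℝ p μ) :
    eLpNorm (T f) q ν = eLpNorm f q μ :=
  (hT.identDistrib hp f).eLpNorm_eq q

theorem IsUnitalLatticeMap.norm_lpInclusion_eq {T : Lp ℝ p μ ≃ₗᵢ[ℝ] Lp ℝ p ν}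
    (hT : IsUnitalLatticeMap T) (hp : p ≠ ∞) {q : ℝ≥0∞} (hqp : q ≤ p) (f : Lp ℝ p μ) :
    ‖lpInclusion ν hqp (T f)‖ = ‖lpInclusion μ hqp f‖ := by
  rw [Lp.norm_def, Lp.norm_def, coeFn_lpInclusion, coeFn_lpInclusion, hT.eLpNorm_eq hp]

theorem IsUnitalLatticeMap.symm {T : Lp ℝ p μ ≃ₗᵢ[ℝ] Lp ℝ p ν}
    (hT : IsUnitalLatticeMap T) : IsUnitalLatticeMap T.symm where
  map_sup f h := T.injective (by simp [hT.map_sup])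
  map_inf f h := T.injective (by simp [hT.map_inf])
  map_const c := T.injective (by simp [hT.map_const])

end Distribution

/-! ### Extension and restriction of unital lattice isometries -/

section Extension

/-- A bijective linear isometry between `L^p`-spaces that preserves suprema on a dense set
preserves the lattice operations. -/
theorem preservesLattice_of_dense {X Y : Type*} [MeasurableSpace X] [MeasurableSpace Y]
    {μ : Measure X} {ν : Measure Y} {p : ℝ≥0∞} [Fact (1 ≤ p)] {T : Lp ℝ p μ ≃ₗᵢ[ℝ] Lp ℝ p ν}
    {V : Type*} {i : V → Lp ℝ p μ} (hi : DenseRange i)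
    (h : ∀ v w, T (i v ⊔ i w) = T (i v) ⊔ T (i w)) : PreservesLattice T := by
  have hsup : ∀ f h, T (f ⊔ h) = T f ⊔ T h := by
    refine hi.induction_on₂ (isClosed_eq ?_ ?_) h
    · exact T.continuous.comp continuous_sup
    · exact (T.continuous.comp continuous_fst).sup (T.continuous.comp continuous_snd)
  refine ⟨hsup, fun f h => ?_⟩
  have h1 : ∀ f h : Lp ℝ p μ, f ⊓ h = -(-f ⊔ -h) := fun f h => by simp [neg_sup]
  have h2 : ∀ f h : Lp ℝ p ν, f ⊓ h = -(-f ⊔ -h) := fun f h => by simp [neg_sup]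
  rw [h1, h2, map_neg, hsup, map_neg, map_neg]

variable {X Y : Type*} [MeasurableSpace X] [MeasurableSpace Y] {μ : Measure X} {ν : Measure Y}
  [IsProbabilityMeasure μ] [IsProbabilityMeasure ν] {p : ℝ≥0∞} [Fact (1 ≤ p)]

/-- A unital lattice isometry of `L^p` extends to one of `L^q` for `q ≤ p`. -/
theorem IsUnitalLatticeMap.exists_extension {T : Lp ℝ p μ ≃ₗᵢ[ℝ] Lp ℝ p ν}
    (hT : IsUnitalLatticeMap T) (hp : p ≠ ∞) {q : ℝ≥0∞} [Fact (1 ≤ q)] (hqp : q ≤ p) :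
    ∃ S : Lp ℝ q μ ≃ₗᵢ[ℝ] Lp ℝ q ν, IsUnitalLatticeMap S ∧
      ∀ f, S (lpInclusion μ hqp f) = lpInclusion ν hqp (T f) := by
  have hq : q ≠ ∞ := ne_top_of_le_ne_top hp hqp
  have hd : DenseRange (lpInclusionₗ μ hqp) := denseRange_lpInclusion hq hqp
  have hd' : DenseRange (lpInclusionₗ ν hqp) := denseRange_lpInclusion hq hqp
  let S := T.toLinearEquiv.extendOfIsometry (lpInclusionₗ μ hqp) (lpInclusionₗ ν hqp) hd hd'
    (hT.norm_lpInclusion_eq hp hqp)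
  have hS : ∀ f, S (lpInclusion μ hqp f) = lpInclusion ν hqp (T f) := fun f =>
    LinearEquiv.extendOfIsometry_eq _ _ _ hd hd' _ f
  refine ⟨S, ⟨preservesLattice_of_dense (denseRange_lpInclusion hq hqp) fun v w => ?_,
    fun c => ?_⟩, hS⟩
  · rw [← lpInclusion_sup, hS, hS, hS, hT.map_sup, lpInclusion_sup]
  · rw [← lpInclusion_const hqp, hS, hT.map_const, lpInclusion_const]

/-- A unital lattice isometry of `L^q` restricts to one of `L^p` for `q ≤ p`. -/
theorem IsUnitalLatticeMap.exists_restriction {q : ℝ≥0∞} [Fact (1 ≤ q)]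
    {S : Lp ℝ q μ ≃ₗᵢ[ℝ] Lp ℝ q ν}
    (hS : IsUnitalLatticeMap S) (hq : q ≠ ∞) (hqp : q ≤ p) :
    ∃ T : Lp ℝ p μ ≃ₗᵢ[ℝ] Lp ℝ p ν, IsUnitalLatticeMap T ∧
      ∀ f, lpInclusion ν hqp (T f) = S (lpInclusion μ hqp f) := by
  have key : ∀ f : Lp ℝ p μ, ∃ h : Lp ℝ p ν, lpInclusion ν hqp h = S (lpInclusion μ hqp f) := by
    intro f
    refine ⟨⟨(S (lpInclusion μ hqp f)).1, ?_⟩, rfl⟩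
    rw [Lp.mem_Lp_iff_eLpNorm_lt_top, hS.eLpNorm_eq hq]
    exact Lp.eLpNorm_lt_top f
  have key' : ∀ f : Lp ℝ p ν, ∃ h : Lp ℝ p μ,
      lpInclusion μ hqp h = S.symm (lpInclusion ν hqp f) := by
    intro f
    refine ⟨⟨(S.symm (lpInclusion ν hqp f)).1, ?_⟩, rfl⟩
    rw [Lp.mem_Lp_iff_eLpNorm_lt_top, hS.symm.eLpNorm_eq hq]
    exact Lp.eLpNorm_lt_top f
  choose a ha using key
  choose b hb using key'
  have inj := lpInclusion_injective (μ := μ) hqp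
  have inj' := lpInclusion_injective (μ := ν) hqp
  let T : Lp ℝ p μ ≃ₗᵢ[ℝ] Lp ℝ p ν :=
    { toFun := a
      invFun := b
      map_add' := fun f h => inj' (by rw [map_add, ha, ha, ha, map_add, map_add])
      map_smul' := fun c f => inj' (by
        rw [RingHom.id_apply, lpInclusion_smul, ha, ha, lpInclusion_smul, map_smul])
      left_inv := fun f => inj (by rw [hb, ha, S.symm_apply_apply])
      right_inv := fun f => inj' (by rw [ha, hb, S.apply_symm_apply])
      norm_map' := fun f => by
        change ‖a f‖ = ‖f‖
        rw [Lp.norm_def, Lp.norm_def, ← coeFn_lpInclusion hqp (a f), ha, hS.eLpNorm_eq hq,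
          coeFn_lpInclusion] }
  have hT : ∀ f, lpInclusion ν hqp (T f) = S (lpInclusion μ hqp f) := ha
  refine ⟨T, ⟨⟨fun f h => inj' ?_, fun f h => inj' ?_⟩, fun c => inj' ?_⟩, hT⟩
  · rw [lpInclusion_sup, hT, hT, hT, lpInclusion_sup, hS.map_sup]
  · rw [lpInclusion_inf, hT, hT, hT, lpInclusion_inf, hS.map_inf]
  · rw [hT, lpInclusion_const, lpInclusion_const, hS.map_const]

end Extension

/-! ### The natural family of representations -/

section UnitalLatticeMap

variable {X Y : Type*} [MeasurableSpace X] [MeasurableSpace Y] {μ : Measure X} {ν : Measure Y}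
  [IsFiniteMeasure μ] [IsFiniteMeasure ν] {p : ℝ≥0∞} [Fact (1 ≤ p)]
  {T : Lp ℝ p μ ≃ₗᵢ[ℝ] Lp ℝ p ν}

theorem IsUnitalLatticeMap.monotone (hT : IsUnitalLatticeMap T) : Monotone T := fun f h hfh => by
  rw [← sup_eq_right, ← hT.map_sup, sup_eq_right.2 hfh]

theorem IsUnitalLatticeMap.map_abs (hT : IsUnitalLatticeMap T) (f : Lp ℝ p μ) :
    T |f| = |T f| := by
  rw [abs, abs, hT.map_sup, map_neg]

theorem IsUnitalLatticeMap.abs_le_const (hT : IsUnitalLatticeMap T) {f : Lp ℝ p μ} {c : ℝ}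
    (hf : |f| ≤ Lp.const p μ c) : |T f| ≤ Lp.const p ν c := by
  rw [← hT.map_abs, ← hT.map_const]
  exact hT.monotone hf

end UnitalLatticeMap

section StrongContinuity

/-- If the orbit maps of an isometric action are continuous on a dense set of vectors, then all of
them are. -/
theorem continuous_orbit_of_dense {G E : Type*} [TopologicalSpace G] [NormedAddCommGroup E]
    [NormedSpace ℝ E] (ρ : G → (E ≃ₗᵢ[ℝ] E)) {s : Set E} (hs : Dense s)
    (h : ∀ f ∈ s, Continuous fun g => ρ g f) (f : E) : Continuous fun g => ρ g f := by
  refine continuous_of_uniform_approx_of_continuous fun u hu => ?_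
  obtain ⟨ε, hε, hu⟩ := Metric.mem_uniformity_dist.1 hu
  obtain ⟨f', hf', hd⟩ := Metric.dense_iff.1 hs f ε hε
  refine ⟨fun g => ρ g f', h f' hd, fun g => hu ?_⟩
  rw [(ρ g).dist_map, dist_comm]
  exact hf'

variable {X : Type*} [MeasurableSpace X] {μ : Measure X} [IsProbabilityMeasure μ] {p : ℝ≥0∞}

/-- On elements bounded by `C`, the `L^p`-norm is controlled by the `L^1`-norm. -/
theorem norm_rpow_le_of_abs_le_const (h1 : 1 ≤ p) (hp : p ≠ ∞) {f : Lp ℝ p μ} {C : ℝ}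
    (hC : 0 ≤ C) (hf : |f| ≤ Lp.const p μ C) :
    ‖f‖ ^ p.toReal ≤ C ^ (p.toReal - 1) * ‖lpInclusion μ h1 f‖ := by
  have hp0 : p ≠ 0 := (zero_lt_one.trans_le h1).ne'
  have hp1 : 1 ≤ p.toReal := by simpa using ENNReal.toReal_mono hp h1
  have hpp : 0 < p.toReal := zero_lt_one.trans_le hp1
  have hmain : eLpNorm f p μ ^ p.toReal ≤
      ENNReal.ofReal C ^ (p.toReal - 1) * eLpNorm f 1 μ := by
    rw [eLpNorm_eq_lintegral_rpow_enorm_toReal hp0 hp, ← ENNReal.rpow_mul,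
      one_div_mul_cancel hpp.ne', ENNReal.rpow_one, eLpNorm_one_eq_lintegral_enorm,
      ← lintegral_const_mul' _ _ (by finiteness)]
    refine lintegral_mono_ae ?_
    filter_upwards [Lp.abs_le_const_iff.1 hf] with x hx
    calc ‖f x‖ₑ ^ p.toReal = ‖f x‖ₑ ^ (p.toReal - 1) * ‖f x‖ₑ := by
          conv_lhs => rw [← sub_add_cancel p.toReal 1,
            ENNReal.rpow_add_of_nonneg _ _ (sub_nonneg.2 hp1) zero_le_one, ENNReal.rpow_one]
      _ ≤ _ := by
          gcongr
          rw [Real.enorm_eq_ofReal_abs]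
          exact ENNReal.ofReal_le_ofReal hx
  have h := ENNReal.toReal_mono (by finiteness [Lp.eLpNorm_ne_top (lpInclusion μ h1 f)]) hmain
  rw [← ENNReal.toReal_rpow, ENNReal.toReal_mul, ← ENNReal.toReal_rpow,
    ENNReal.toReal_ofReal hC] at h
  exact h

end StrongContinuity

section Family

variable {G X : Type*} [Group G] [TopologicalSpace G] [MeasurableSpace X] {μ : Measure X}
  {p : ℝ≥0∞} [Fact (1 ≤ p)]

theorem IsStronglyContinuousLatticeRep.isUnitalLatticeMap [IsFiniteMeasure μ]
    {ρ : G →* (Lp ℝ p μ ≃ₗᵢ[ℝ] Lp ℝ p μ)} (hρ : IsStronglyContinuousLatticeRep ρ) (g : G) :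
    IsUnitalLatticeMap (ρ g) :=
  ⟨hρ.lattice g, hρ.fixes_const g⟩

variable [IsProbabilityMeasure μ]

/-- A strongly continuous representation on `L^p` by unital lattice isometries extends to `L^1`. -/
theorem IsStronglyContinuousLatticeRep.exists_extension
    {ρ : G →* (Lp ℝ p μ ≃ₗᵢ[ℝ] Lp ℝ p μ)} (hρ : IsStronglyContinuousLatticeRep ρ) (h1 : 1 ≤ p)
    (hp : p ≠ ∞) : ∃ σ : G →* (Lp ℝ 1 μ ≃ₗᵢ[ℝ] Lp ℝ 1 μ), IsStronglyContinuousLatticeRep σ ∧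
      ∀ g f, σ g (lpInclusion μ h1 f) = lpInclusion μ h1 (ρ g f) := by
  choose σ hσ hσρ using fun g => (hρ.isUnitalLatticeMap g).exists_extension hp h1
  have hd : DenseRange (lpInclusion μ h1) := denseRange_lpInclusion ENNReal.one_ne_top h1
  have hext : ∀ S S' : Lp ℝ 1 μ ≃ₗᵢ[ℝ] Lp ℝ 1 μ,
      (∀ f, S (lpInclusion μ h1 f) = S' (lpInclusion μ h1 f)) → S = S' := fun S S' h =>
    LinearIsometryEquiv.ext fun f =>
      congrFun (hd.equalizer S.continuous S'.continuous (funext h)) f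
  refine ⟨⟨⟨σ, hext _ _ fun f => ?_⟩, fun g h => hext _ _ fun f => ?_⟩,
    ⟨fun g => (hσ g).toPreservesLattice, fun g => (hσ g).map_const,
      continuous_orbit_of_dense _ hd ?_⟩, hσρ⟩
  · rw [hσρ, map_one]
    rfl
  · rw [LinearIsometryEquiv.coe_mul, Function.comp_apply, hσρ, hσρ, hσρ, map_mul]
    rfl
  · rintro _ ⟨f, rfl⟩
    exact ((continuous_lpInclusion h1).comp (hρ.continuous f)).congr fun g => (hσρ g f).symm

/-- A strongly continuous representation on `L^1` by unital lattice isometries restricts to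
`L^p`. -/
theorem IsStronglyContinuousLatticeRep.exists_restriction
    {σ : G →* (Lp ℝ 1 μ ≃ₗᵢ[ℝ] Lp ℝ 1 μ)} (hσ : IsStronglyContinuousLatticeRep σ) (h1 : 1 ≤ p)
    (hp : p ≠ ∞) : ∃ ρ : G →* (Lp ℝ p μ ≃ₗᵢ[ℝ] Lp ℝ p μ), IsStronglyContinuousLatticeRep ρ ∧
      ∀ g f, lpInclusion μ h1 (ρ g f) = σ g (lpInclusion μ h1 f) := by
  choose ρ hρ hρσ using fun g => (hσ.isUnitalLatticeMap g).exists_restriction ENNReal.one_ne_top h1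
  have inj := lpInclusion_injective (μ := μ) h1
  have hp1 : 1 ≤ p.toReal := by simpa using ENNReal.toReal_mono hp h1
  have hpp : 0 < p.toReal := zero_lt_one.trans_le hp1
  refine ⟨⟨⟨ρ, LinearIsometryEquiv.ext fun f => inj ?_⟩,
    fun g h => LinearIsometryEquiv.ext fun f => inj ?_⟩,
    ⟨fun g => (hρ g).toPreservesLattice, fun g => (hρ g).map_const,
      continuous_orbit_of_dense _ (Lp.dense_isBounded hp) ?_⟩, hρσ⟩
  · rw [hρσ, map_one]
    rfl
  · rw [LinearIsometryEquiv.coe_mul, Function.comp_apply, hρσ, hρσ, hρσ, map_mul]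
    rfl
  · rintro f ⟨c, hc⟩
    refine continuous_iff_continuousAt.2 fun g₀ => tendsto_iff_norm_sub_tendsto_zero.2 ?_
    have hbd : ∀ g, |ρ g f - ρ g₀ f| ≤ Lp.const p μ (|c| + |c|) := fun g => by
      rw [map_add]
      have hc' := Lp.const_le_const (μ := μ) p (le_abs_self c)
      rw [sub_eq_add_neg]
      refine (abs_add_le _ _).trans (add_le_add (((hρ g).abs_le_const hc).trans hc') ?_)
      rw [abs_neg]
      exact ((hρ g₀).abs_le_const hc).trans hc'
    have hle : ∀ g, ‖ρ g f - ρ g₀ f‖ ≤ ((|c| + |c|) ^ (p.toReal - 1) *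
        ‖σ g (lpInclusion μ h1 f) - σ g₀ (lpInclusion μ h1 f)‖) ^ (1 / p.toReal) := fun g => by
      rw [← hρσ, ← hρσ, ← map_sub]
      refine le_trans (le_of_eq ?_) (Real.rpow_le_rpow (by positivity)
        (norm_rpow_le_of_abs_le_const h1 hp (by positivity) (hbd g)) (by positivity))
      rw [← Real.rpow_mul (norm_nonneg _), mul_one_div_cancel hpp.ne', Real.rpow_one]
    have hlim : Tendsto (fun g => ((|c| + |c|) ^ (p.toReal - 1) *
        ‖σ g (lpInclusion μ h1 f) - σ g₀ (lpInclusion μ h1 f)‖) ^ (1 / p.toReal)) (𝓝 g₀)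
        (𝓝 0) := by
      have := (((tendsto_iff_norm_sub_tendsto_zero.1
        ((hσ.continuous (lpInclusion μ h1 f)).tendsto g₀)).const_mul
          ((|c| + |c|) ^ (p.toReal - 1))).rpow_const (p := 1 / p.toReal)
          (Or.inr (by positivity)))
      rwa [mul_zero, Real.zero_rpow (by positivity)] at this
    exact squeeze_zero (fun _ => norm_nonneg _) hle hlim

/-- The exponent `1`. -/
def FiniteExponent.one : FiniteExponent := ⟨1, le_rfl, ENNReal.one_ne_top⟩

theorem existsUnique_isNaturalFamily {p₀ : FiniteExponent}
    {ρ₀ : G →* (Lp ℝ (p₀ : ℝ≥0∞) μ ≃ₗᵢ[ℝ] Lp ℝ (p₀ : ℝ≥0∞) μ)}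
    (hρ₀ : IsStronglyContinuousLatticeRep ρ₀) :
    ∃! ρ : ∀ p : FiniteExponent, G →* (Lp ℝ (p : ℝ≥0∞) μ ≃ₗᵢ[ℝ] Lp ℝ (p : ℝ≥0∞) μ),
      IsNaturalFamily ρ₀ ρ := by
  obtain ⟨σ, hσ, hσρ₀⟩ := hρ₀.exists_extension p₀.2.1 p₀.2.2
  choose ρ hρ hρσ using fun p : FiniteExponent => hσ.exists_restriction p.2.1 p.2.2
  refine ⟨ρ, ⟨?_, hρ, fun p q hpq g f => ?_⟩, fun ρ' hρ' => ?_⟩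
  · refine MonoidHom.ext fun g => LinearIsometryEquiv.ext fun f =>
      lpInclusion_injective p₀.2.1 ?_
    rw [hρσ, hσρ₀]
  · apply lpInclusion_injective p.2.1
    rw [hρσ]
    exact (hρσ q g f).symm
  · -- The representation on `L^1` is determined on the dense subspace `L^{p₀}`, and it determines
    -- the others by restriction.
    let σ' : G →* (Lp ℝ 1 μ ≃ₗᵢ[ℝ] Lp ℝ 1 μ) := ρ' FiniteExponent.one
    have hcomp : ∀ (p : FiniteExponent) g f,
        σ' g (lpInclusion μ p.2.1 f) = lpInclusion μ p.2.1 (ρ' p g f) := fun p g f =>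
      hρ'.compatible FiniteExponent.one p p.2.1 g f
    have hone : ∀ g f, σ' g f = σ g f := fun g f =>
      congrFun ((denseRange_lpInclusion ENNReal.one_ne_top p₀.2.1).equalizer
        (σ' g).continuous (σ g).continuous (funext fun h => by
          rw [Function.comp_apply, Function.comp_apply, hσρ₀, hcomp, hρ'.base])) f
    refine funext fun p => MonoidHom.ext fun g => LinearIsometryEquiv.ext fun f =>
      lpInclusion_injective p.2.1 ?_
    rw [hρσ, ← hone, hcomp]

end Family

/-! ### The spectrum of a unital sublattice of bounded functions -/

section Spectrum

variable {X : Type u} [MeasurableSpace X] {μ : Measure X} [IsProbabilityMeasure μ]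

/-- A linear subspace of `L^1` that consists of bounded functions, contains the constants, and is
closed under the lattice operations. -/
structure IsUnitalBoundedSublattice (B : Submodule ℝ (Lp ℝ 1 μ)) : Prop where
  sup_mem : ∀ f ∈ B, ∀ h ∈ B, f ⊔ h ∈ B
  one_mem : Lp.const 1 μ (1 : ℝ) ∈ B
  bounded : ∀ f ∈ B, Lp.IsBounded f

/-- A unital real-valued lattice homomorphism on `B`. The laws that involve the lattice operations
and the unit refer to `L^1`, so that `B` itself need not carry a lattice structure. -/
structure IsLatticeCharacter (B : Submodule ℝ (Lp ℝ 1 μ)) (x : B → ℝ) : Prop where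
  map_add : ∀ f h : B, x (f + h) = x f + x h
  map_smul : ∀ (c : ℝ) (f : B), x (c • f) = c * x f
  map_sup : ∀ f h k : B, (k : Lp ℝ 1 μ) = (f : Lp ℝ 1 μ) ⊔ h → x k = max (x f) (x h)
  map_one : ∀ k : B, (k : Lp ℝ 1 μ) = Lp.const 1 μ 1 → x k = 1

/-- The space of all unital lattice homomorphisms `B → ℝ`, with the topology of pointwise
convergence. -/
abbrev LatticeSpectrum (B : Submodule ℝ (Lp ℝ 1 μ)) : Type u :=
  {x : B → ℝ // IsLatticeCharacter B x}

variable {B : Submodule ℝ (Lp ℝ 1 μ)}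

theorem IsUnitalBoundedSublattice.const_mem (hB : IsUnitalBoundedSublattice B) (c : ℝ) :
    Lp.const 1 μ c ∈ B :=
  Lp.const_eq_smul (μ := μ) 1 c ▸ B.smul_mem c hB.one_mem

theorem IsUnitalBoundedSublattice.abs_mem (hB : IsUnitalBoundedSublattice B) {f : Lp ℝ 1 μ}
    (hf : f ∈ B) : |f| ∈ B :=
  hB.sup_mem f hf (-f) (B.neg_mem hf)

namespace IsLatticeCharacter

variable {x : B → ℝ}

theorem map_neg (hx : IsLatticeCharacter B x) (f : B) : x (-f) = -x f := by
  rw [← neg_one_smul ℝ, hx.map_smul, neg_one_mul]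

theorem map_sub (hx : IsLatticeCharacter B x) (f h : B) : x (f - h) = x f - x h := by
  rw [sub_eq_add_neg, hx.map_add, hx.map_neg, sub_eq_add_neg]

theorem mono (hx : IsLatticeCharacter B x) {f h : B} (hfh : (f : Lp ℝ 1 μ) ≤ h) : x f ≤ x h := by
  rw [hx.map_sup f h h (sup_eq_right.2 hfh).symm]
  exact le_max_left _ _

theorem map_const (hx : IsLatticeCharacter B x) (hB : IsUnitalBoundedSublattice B) {k : B} {c : ℝ}
    (hk : (k : Lp ℝ 1 μ) = Lp.const 1 μ c) : x k = c := by
  have : k = c • (⟨Lp.const 1 μ 1, hB.one_mem⟩ : B) := by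
    ext1
    rw [hk, Lp.const_eq_smul, Submodule.coe_smul]
  rw [this, hx.map_smul, hx.map_one _ rfl, mul_one]

theorem le_of_le_const (hx : IsLatticeCharacter B x) (hB : IsUnitalBoundedSublattice B) {f : B}
    {c : ℝ} (hf : (f : Lp ℝ 1 μ) ≤ Lp.const 1 μ c) : x f ≤ c := by
  exact (hx.mono (h := ⟨_, hB.const_mem c⟩) hf).trans_eq (hx.map_const hB rfl)

theorem abs_le (hx : IsLatticeCharacter B x) (hB : IsUnitalBoundedSublattice B) {f : B}
    {c : ℝ} (hf : |(f : Lp ℝ 1 μ)| ≤ Lp.const 1 μ c) : |x f| ≤ c := by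
  refine _root_.abs_le'.2 ⟨hx.le_of_le_const hB ((le_abs_self _).trans hf), ?_⟩
  rw [← hx.map_neg]
  exact hx.le_of_le_const hB ((neg_le_abs _).trans hf)

theorem abs_sub_le (hx : IsLatticeCharacter B x) (hB : IsUnitalBoundedSublattice B) {f h : B}
    {c : ℝ} (hfh : |(f : Lp ℝ 1 μ) - h| ≤ Lp.const 1 μ c) : |x f - x h| ≤ c := by
  rw [← hx.map_sub]
  exact hx.abs_le hB hfh

end IsLatticeCharacter

theorem isClosed_setOf_isLatticeCharacter : IsClosed {x : B → ℝ | IsLatticeCharacter B x} := by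
  have : {x : B → ℝ | IsLatticeCharacter B x} =
      {x | (∀ f h : B, x (f + h) = x f + x h) ∧ (∀ (c : ℝ) (f : B), x (c • f) = c * x f) ∧
        (∀ f h k : B, (k : Lp ℝ 1 μ) = (f : Lp ℝ 1 μ) ⊔ h → x k = max (x f) (x h)) ∧
        (∀ k : B, (k : Lp ℝ 1 μ) = Lp.const 1 μ 1 → x k = 1)} := by
    ext x
    exact ⟨fun h => ⟨h.1, h.2, h.3, h.4⟩, fun h => ⟨h.1, h.2.1, h.2.2.1, h.2.2.2⟩⟩
  rw [this]
  simp only [Set.ofPred_and, Set.ofPred_forall]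
  refine IsClosed.inter ?_ (IsClosed.inter ?_ (IsClosed.inter ?_ ?_))
  · exact isClosed_iInter fun f => isClosed_iInter fun h => isClosed_eq (by fun_prop) (by fun_prop)
  · exact isClosed_iInter fun f => isClosed_iInter fun h => isClosed_eq (by fun_prop) (by fun_prop)
  · exact isClosed_iInter fun f => isClosed_iInter fun h => isClosed_iInter fun k =>
      isClosed_iInter fun _ => isClosed_eq (by fun_prop) (by fun_prop)
  · exact isClosed_iInter fun f => isClosed_iInter fun h => isClosed_eq (by fun_prop) (by fun_prop)

theorem compactSpace_latticeSpectrum (hB : IsUnitalBoundedSublattice B) :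
    CompactSpace (LatticeSpectrum B) := by
  choose c hc using fun f : B => hB.bounded f f.2
  refine isCompact_iff_compactSpace.1 (IsCompact.of_isClosed_subset
    (isCompact_univ_pi fun f : B => isCompact_Icc (a := -c f) (b := c f))
    isClosed_setOf_isLatticeCharacter ?_)
  intro x hx f _
  exact _root_.abs_le.1 (IsLatticeCharacter.abs_le hx hB (hc f))

/-- Lattice characters separate `B` from the complement of its positive cone: the limits along an
ultrafilter finer than the filter of conull sets form a lattice character, and the ultrafilter may
be chosen to contain any given set of positive measure. -/
theorem nonneg_of_forall_latticeCharacter_nonneg (hB : IsUnitalBoundedSublattice B) {f : B}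
    (hf : ∀ x : LatticeSpectrum B, 0 ≤ x.1 f) : 0 ≤ (f : Lp ℝ 1 μ) := by
  by_contra hneg
  obtain ⟨n, hn⟩ : ∃ n : ℕ, ∃ᶠ t in ae μ, (f : Lp ℝ 1 μ) t ≤ -(1 / ((n : ℝ) + 1)) := by
    by_contra! hall
    refine hneg ((Lp.coeFn_nonneg _).1 ?_)
    have hall' : ∀ᵐ t ∂μ, ∀ n : ℕ, -(1 / ((n : ℝ) + 1)) < (f : Lp ℝ 1 μ) t := ae_all_iff.2 hall
    filter_upwards [hall'] with t ht
    refine le_of_forall_pos_lt_add fun ε hε => ?_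
    obtain ⟨n, hn⟩ := exists_nat_one_div_lt hε
    have := ht n
    rw [Pi.zero_apply]
    linarith
  have hne : (ae μ ⊓ 𝓟 {t | (f : Lp ℝ 1 μ) t ≤ -(1 / ((n : ℝ) + 1))}).NeBot :=
    frequently_mem_iff_neBot.1 hn
  let 𝒰 := Ultrafilter.of (ae μ ⊓ 𝓟 {t | (f : Lp ℝ 1 μ) t ≤ -(1 / ((n : ℝ) + 1))})
  have hle := Ultrafilter.of_le (ae μ ⊓ 𝓟 {t | (f : Lp ℝ 1 μ) t ≤ -(1 / ((n : ℝ) + 1))})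
  have hae : (𝒰 : Filter X) ≤ ae μ := hle.trans inf_le_left
  have hlim : ∀ h : B, ∃ a : ℝ, Tendsto (h : Lp ℝ 1 μ) 𝒰 (𝓝 a) := by
    intro h
    obtain ⟨c, hc⟩ := hB.bounded h h.2
    have hmem : (𝒰.map (h : Lp ℝ 1 μ) : Filter ℝ) ≤ 𝓟 (Set.Icc (-c) c) := by
      rw [le_principal_iff]
      exact hae ((Lp.abs_le_const_iff.1 hc).mono fun t ht => _root_.abs_le.1 ht)
    obtain ⟨a, -, ha⟩ := (isCompact_Icc (a := -c) (b := c)).ultrafilter_le_nhds _ hmem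
    exact ⟨a, ha⟩
  choose x hx using hlim
  have hchar : IsLatticeCharacter B x := by
    refine ⟨fun h k => ?_, fun c h => ?_, fun h k l hl => ?_, fun k hk => ?_⟩
    · refine tendsto_nhds_unique (hx (h + k)) (((hx h).add (hx k)).congr' ?_)
      exact hae (Lp.coeFn_add (h : Lp ℝ 1 μ) k).symm
    · refine tendsto_nhds_unique (hx (c • h)) (((hx h).const_mul c).congr' ?_)
      exact hae (Lp.coeFn_smul c (h : Lp ℝ 1 μ)).symm
    · refine tendsto_nhds_unique (hx l) (((hx h).max (hx k)).congr' ?_)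
      rw [hl]
      exact hae (Lp.coeFn_sup (h : Lp ℝ 1 μ) k).symm
    · refine tendsto_nhds_unique (hx k) (tendsto_const_nhds.congr' ?_)
      rw [hk]
      exact hae (Lp.coeFn_const 1 μ (1 : ℝ)).symm
  have hx0 : x f ≤ -(1 / ((n : ℝ) + 1)) :=
    le_of_tendsto (hx f) (hle (mem_inf_of_right (mem_principal_self _)))
  have hpos : 0 < 1 / ((n : ℝ) + 1) := by positivity
  linarith [hf ⟨x, hchar⟩]

/-- The representation of the elements of `B` as continuous functions on the spectrum. -/
def gelfandMap (B : Submodule ℝ (Lp ℝ 1 μ)) : B →ₗ[ℝ] C(LatticeSpectrum B, ℝ) where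
  toFun f := ⟨fun x => x.1 f, (continuous_apply f).comp continuous_subtype_val⟩
  map_add' f h := ContinuousMap.ext fun x => x.2.map_add f h
  map_smul' c f := ContinuousMap.ext fun x => x.2.map_smul c f

@[simp]
theorem gelfandMap_apply (f : B) (x : LatticeSpectrum B) : gelfandMap B f x = x.1 f := rfl

theorem gelfandMap_sup {f h k : B} (hk : (k : Lp ℝ 1 μ) = (f : Lp ℝ 1 μ) ⊔ h) :
    gelfandMap B k = gelfandMap B f ⊔ gelfandMap B h :=
  ContinuousMap.ext fun x => x.2.map_sup f h k hk

theorem gelfandMap_abs {f k : B} (hk : (k : Lp ℝ 1 μ) = |(f : Lp ℝ 1 μ)|) :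
    gelfandMap B k = |gelfandMap B f| := by
  rw [abs, ← LinearMap.map_neg]
  exact gelfandMap_sup hk

theorem gelfandMap_const (hB : IsUnitalBoundedSublattice B) (c : ℝ) (x : LatticeSpectrum B) :
    gelfandMap B ⟨Lp.const 1 μ c, hB.const_mem c⟩ x = c :=
  x.2.map_const hB rfl

/-- By the Stone–Weierstrass theorem for lattices, the elements of `B` are dense in the continuous
functions on the spectrum. -/
theorem denseRange_gelfandMap (hB : IsUnitalBoundedSublattice B)
    [CompactSpace (LatticeSpectrum B)] :
    DenseRange (gelfandMap B) := by
  have hsup : ∀ f ∈ Set.range (gelfandMap B), ∀ h ∈ Set.range (gelfandMap B),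
      f ⊔ h ∈ Set.range (gelfandMap B) := by
    rintro _ ⟨f, rfl⟩ _ ⟨h, rfl⟩
    exact ⟨⟨f ⊔ h, hB.sup_mem f f.2 h h.2⟩, gelfandMap_sup rfl⟩
  have hneg : ∀ f ∈ Set.range (gelfandMap B), -f ∈ Set.range (gelfandMap B) := by
    rintro _ ⟨f, rfl⟩
    exact ⟨-f, LinearMap.map_neg _ f⟩
  rw [DenseRange, dense_iff_closure_eq]
  refine ContinuousMap.sublattice_closure_eq_top _ ⟨_, 0, rfl⟩ (fun f hf h hh => ?_) hsup ?_
  · have : f ⊓ h = -(-f ⊔ -h) := by simp [neg_sup]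
    rw [this]
    exact hneg _ (hsup _ (hneg _ hf) _ (hneg _ hh))
  · intro v x y
    obtain ⟨e, he⟩ : ∃ e : B, ∀ z : LatticeSpectrum B, z.1 e = 1 :=
      ⟨⟨Lp.const 1 μ 1, hB.one_mem⟩, fun z => z.2.map_one _ rfl⟩
    by_cases hxy : x = y
    · subst hxy
      refine ⟨_, ⟨v x • e, rfl⟩, ?_, ?_⟩ <;> simp [he]
    · obtain ⟨f, hf⟩ : ∃ f, x.1 f ≠ y.1 f := by
        by_contra! h
        exact hxy (Subtype.ext (funext h))
      have hf' : x.1 f - y.1 f ≠ 0 := sub_ne_zero.2 hf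
      -- The affine function of `f` that interpolates the prescribed values.
      let a := (v x - v y) / (x.1 f - y.1 f)
      refine ⟨_, ⟨a • f + (v x - a * x.1 f) • e, rfl⟩, ?_, ?_⟩
      · simp [he]
      · simp only [gelfandMap_apply, y.2.map_add, y.2.map_smul, he, a]
        field_simp
        ring

theorem nonneg_of_gelfandMap_nonneg (hB : IsUnitalBoundedSublattice B) {f : B}
    (hf : 0 ≤ gelfandMap B f) : 0 ≤ (f : Lp ℝ 1 μ) :=
  nonneg_of_forall_latticeCharacter_nonneg hB hf

end Spectrum

/-! ### The measure on the spectrum and the isomorphism of `L^1`-spaces -/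

section Model

variable {X : Type u} [MeasurableSpace X] {μ : Measure X} [IsProbabilityMeasure μ]
  {B : Submodule ℝ (Lp ℝ 1 μ)}

/-- On a compact Hausdorff space, every continuous linear functional that is nonnegative on
nonnegative functions is integration against a regular finite measure. -/
theorem exists_regular_measure_integral_eq {K : Type*} [TopologicalSpace K] [CompactSpace K]
    [T2Space K] [MeasurableSpace K] [BorelSpace K] (Λ : C(K, ℝ) →L[ℝ] ℝ)
    (hΛ : ∀ h, 0 ≤ h → 0 ≤ Λ h) :
    ∃ ν : Measure K, ν.Regular ∧ IsFiniteMeasure ν ∧ ∀ h : C(K, ℝ), ∫ x, h x ∂ν = Λ h := by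
  let Λ' : CompactlySupportedContinuousMap K ℝ →ₚ[ℝ] ℝ :=
    { toFun := fun h => Λ h.toContinuousMap
      map_add' := fun g h => Λ.map_add _ _
      map_smul' := fun c h => Λ.map_smul _ _
      monotone' := fun g h hgh => by
        have := hΛ (h.toContinuousMap - g.toContinuousMap) fun x => sub_nonneg.2 (hgh x)
        rw [map_sub] at this
        exact sub_nonneg.1 this }
  refine ⟨RealRMK.rieszMeasure Λ', inferInstance, inferInstance, fun h => ?_⟩
  exact RealRMK.integral_rieszMeasure Λ' ⟨h, HasCompactSupport.of_compactSpace h⟩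

/-- Regular finite measures on a compact Hausdorff space are determined by the integrals of a dense
set of continuous functions. -/
theorem Measure.ext_of_integral_eq_on_dense {K : Type*} [TopologicalSpace K] [CompactSpace K]
    [T2Space K] [MeasurableSpace K] [BorelSpace K] {ν ν' : Measure K} [ν.Regular] [ν'.Regular]
    {V : Type*} {i : V → C(K, ℝ)} (hi : DenseRange i)
    (h : ∀ f, ∫ x, i f x ∂ν = ∫ x, i f x ∂ν') : ν = ν' := by
  have hcont : ∀ ξ : Measure K, ξ.Regular → Continuous fun h : C(K, ℝ) => ∫ x, h x ∂ξ := by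
    intro ξ _
    have : (fun h : C(K, ℝ) => ∫ x, h x ∂ξ) =
        fun h => L1.integral (ContinuousMap.toLp 1 ξ ℝ h) := by
      funext h
      rw [L1.integral_eq_integral]
      exact integral_congr_ae (ContinuousMap.coeFn_toLp ξ h).symm
    rw [this]
    exact L1.continuous_integral.comp (ContinuousMap.toLp 1 ξ ℝ).continuous
  refine Measure.ext_of_integral_eq_on_compactlySupported fun f => ?_
  exact congrFun (hi.equalizer (hcont ν inferInstance) (hcont ν' inferInstance) (funext h))
    f.toContinuousMap

theorem integral_le_of_le_const {f : Lp ℝ 1 μ} {c : ℝ} (hf : |f| ≤ Lp.const 1 μ c) :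
    |∫ t, f t ∂μ| ≤ c := by
  simpa using norm_integral_le_of_norm_le_const (μ := μ) (f := f) (C := c)
    (Lp.abs_le_const_iff.1 hf)

theorem abs_le_const_norm_gelfandMap (hB : IsUnitalBoundedSublattice B)
    [CompactSpace (LatticeSpectrum B)] (f : B) :
    |(f : Lp ℝ 1 μ)| ≤ Lp.const 1 μ ‖gelfandMap B f‖ := by
  have h := nonneg_of_gelfandMap_nonneg hB
    (f := ⟨Lp.const 1 μ ‖gelfandMap B f‖, hB.const_mem _⟩ - ⟨|(f : Lp ℝ 1 μ)|, hB.abs_mem f.2⟩) ?_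
  · exact sub_nonneg.1 h
  · rw [ContinuousMap.le_def]
    intro x
    rw [map_sub, ContinuousMap.sub_apply, gelfandMap_const hB,
      gelfandMap_abs (f := f) (k := ⟨_, hB.abs_mem f.2⟩) rfl, ContinuousMap.abs_apply]
    exact sub_nonneg.2 ((gelfandMap B f).norm_coe_le_norm x)

/-- The integral on `B` is represented by a regular probability measure on the spectrum. -/
theorem exists_measure_latticeSpectrum (hB : IsUnitalBoundedSublattice B)
    [CompactSpace (LatticeSpectrum B)] [MeasurableSpace (LatticeSpectrum B)]
    [BorelSpace (LatticeSpectrum B)] :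
    ∃ ν : Measure (LatticeSpectrum B), ν.Regular ∧ IsProbabilityMeasure ν ∧
      ∀ f : B, ∫ x, gelfandMap B f x ∂ν = ∫ t, (f : Lp ℝ 1 μ) t ∂μ := by
  have hd := denseRange_gelfandMap hB
  let I : B →ₗ[ℝ] ℝ := (L1.integralCLM (E := ℝ) (μ := μ)).toLinearMap ∘ₗ B.subtype
  have hI : ∀ f : B, I f = ∫ t, (f : Lp ℝ 1 μ) t ∂μ := fun f => by
    rw [← L1.integral_eq_integral, L1.integral_eq]
    rfl
  let Λ : C(LatticeSpectrum B, ℝ) →L[ℝ] ℝ := I.extendOfNorm (gelfandMap B)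
  have hle : ∀ f, ‖I f‖ ≤ 1 * ‖gelfandMap B f‖ := fun f => by
    rw [one_mul, hI]
    exact integral_le_of_le_const (abs_le_const_norm_gelfandMap hB f)
  have hΛ : ∀ f, Λ (gelfandMap B f) = I f := LinearMap.extendOfNorm_eq hd ⟨1, hle⟩
  have hnorm : ∀ h, ‖Λ h‖ ≤ 1 * ‖h‖ := LinearMap.norm_extendOfNorm_apply_le hd 1 hle
  have hconst : ∀ c : ℝ, Λ (ContinuousMap.const _ c) = c := fun c => by
    have : ContinuousMap.const _ c = gelfandMap B ⟨_, hB.const_mem c⟩ :=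
      ContinuousMap.ext fun x => (gelfandMap_const hB c x).symm
    rw [this, hΛ, hI, integral_congr_ae (Lp.coeFn_const 1 μ c)]
    simp
  -- A unital functional of norm one is positive.
  have hpos : ∀ h, 0 ≤ h → 0 ≤ Λ h := by
    intro h hh
    have h1 : ‖ContinuousMap.const _ ‖h‖ - h‖ ≤ ‖h‖ := by
      refine (ContinuousMap.norm_le _ (norm_nonneg h)).2 fun x => ?_
      have h2 := abs_le.1 (h.norm_coe_le_norm x)
      have h3 : 0 ≤ h x := hh x
      rw [ContinuousMap.sub_apply, ContinuousMap.const_apply, Real.norm_eq_abs, abs_le]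
      constructor <;> linarith
    have h4 := (le_abs_self _).trans ((hnorm _).trans ((one_mul _).trans_le h1))
    rw [map_sub, hconst] at h4
    linarith
  obtain ⟨ν, hν, hfin, hint⟩ := exists_regular_measure_integral_eq Λ hpos
  have hint' : ∀ f : B, ∫ x, gelfandMap B f x ∂ν = ∫ t, (f : Lp ℝ 1 μ) t ∂μ := fun f => by
    rw [hint, hΛ, hI]
  refine ⟨ν, hν, ⟨?_⟩, hint'⟩
  have h1 := (hint (ContinuousMap.const _ 1)).trans (hconst 1)
  simp only [ContinuousMap.const_apply, integral_const, smul_eq_mul, mul_one] at h1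
  rw [← ENNReal.toReal_eq_one_iff]
  exact h1

variable [CompactSpace (LatticeSpectrum B)] [MeasurableSpace (LatticeSpectrum B)]
  {ν : Measure (LatticeSpectrum B)}

theorem support_eq_univ_of_integral_gelfandMap (hB : IsUnitalBoundedSublattice B)
    (hν : ∀ f : B, ∫ x, gelfandMap B f x ∂ν = ∫ t, (f : Lp ℝ 1 μ) t ∂μ) :
    ν.support = Set.univ := by
  have : ν.IsOpenPosMeasure := by
    refine ⟨fun U hU ⟨x₀, hx₀⟩ hνU => ?_⟩
    obtain ⟨h, h1, h0, -, h01⟩ := exists_continuous_one_zero_of_isCompact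
      (isCompact_singleton (x := x₀)) hU.isClosed_compl
      (Set.disjoint_compl_right_iff_subset.2
        (Set.singleton_subset_iff.2 hx₀))
    obtain ⟨_, hd, f, rfl⟩ :=
      Metric.dense_iff.1 (denseRange_gelfandMap hB) h (1 / 3) (by norm_num)
    have hdist : ∀ x, |gelfandMap B f x - h x| < 1 / 3 := fun x =>
      (ContinuousMap.dist_apply_le_dist x).trans_lt hd
    -- The element `(f - 1/3)⁺` is supported in `U` and does not vanish at `x₀`.
    obtain ⟨k, hk, hkx⟩ : ∃ k : B, 0 ≤ (k : Lp ℝ 1 μ) ∧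
        ∀ x, gelfandMap B k x = max (gelfandMap B f x - 1 / 3) 0 := by
      refine ⟨⟨((f : Lp ℝ 1 μ) - Lp.const 1 μ (1 / 3)) ⊔ Lp.const 1 μ 0,
        hB.sup_mem _ (B.sub_mem f.2 (hB.const_mem _)) _ (hB.const_mem _)⟩,
        (map_zero (Lp.const 1 μ (E := ℝ))).symm.le.trans le_sup_right, fun x => ?_⟩
      · rw [gelfandMap_sup (f := f - ⟨Lp.const 1 μ (1 / 3), hB.const_mem _⟩)
          (h := ⟨Lp.const 1 μ 0, hB.const_mem _⟩) rfl, ContinuousMap.sup_apply, map_sub,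
          ContinuousMap.sub_apply, gelfandMap_const hB, gelfandMap_const hB]
    have hint : ∫ t, (k : Lp ℝ 1 μ) t ∂μ = 0 := by
      rw [← hν, integral_eq_zero_of_ae]
      filter_upwards [measure_eq_zero_iff_ae_notMem.1 hνU] with x hx
      have h2 := abs_lt.1 (hdist x)
      rw [h0 hx] at h2
      rw [hkx, Pi.zero_apply, max_eq_right]
      have := h2.2
      simp only [Pi.zero_apply] at this
      linarith
    have hk0 : k = 0 := by
      ext1
      refine Lp.ext (((integral_eq_zero_iff_of_nonneg_ae ((Lp.coeFn_nonneg _).2 hk)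
        (L1.integrable_coeFn _)).1 hint).trans ?_)
      exact (Lp.coeFn_zero _ _ _).symm
    have h3 := hkx x₀
    have h4 := abs_lt.1 (hdist x₀)
    rw [h1 rfl, Pi.one_apply] at h4
    rw [hk0, map_zero, ContinuousMap.zero_apply, max_eq_left (by linarith)] at h3
    linarith
  exact Measure.support_eq_univ

/-- The map `B → C(K)` extends to a lattice isomorphism `L^1(μ) → L^1(ν)`. -/
theorem exists_unitalLatticeIsometry_latticeSpectrum (hB : IsUnitalBoundedSublattice B)
    (hd : Dense (B : Set (Lp ℝ 1 μ))) [BorelSpace (LatticeSpectrum B)] [IsProbabilityMeasure ν]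
    [ν.Regular]
    (hν : ∀ f : B, ∫ x, gelfandMap B f x ∂ν = ∫ t, (f : Lp ℝ 1 μ) t ∂μ) :
    ∃ Φ : Lp ℝ 1 μ ≃ₗᵢ[ℝ] Lp ℝ 1 ν, IsUnitalLatticeMap Φ ∧
      ∀ f : B, Φ f = ContinuousMap.toLp 1 ν ℝ (gelfandMap B f) := by
  let j : B →ₗ[ℝ] Lp ℝ 1 ν := (ContinuousMap.toLp 1 ν ℝ).toLinearMap ∘ₗ gelfandMap B
  have hi : DenseRange B.subtype := by
    rw [DenseRange]
    simpa using hd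
  have hj : DenseRange j := (ContinuousMap.toLp_denseRange ℝ ν ℝ ENNReal.one_ne_top).comp
    (denseRange_gelfandMap hB) (ContinuousMap.toLp 1 ν ℝ).continuous
  have hnorm : ∀ f, ‖j f‖ = ‖B.subtype f‖ := by
    intro f
    rw [L1.norm_eq_integral_norm, L1.norm_eq_integral_norm]
    have h1 : (fun t => ‖(f : Lp ℝ 1 μ) t‖) =ᵐ[μ] ⇑|(f : Lp ℝ 1 μ)| := (Lp.coeFn_abs _).symm
    have h2 : (fun x => ‖j f x‖) =ᵐ[ν] gelfandMap B ⟨|(f : Lp ℝ 1 μ)|, hB.abs_mem f.2⟩ := by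
      filter_upwards [ContinuousMap.coeFn_toLp (p := 1) (𝕜 := ℝ) ν (gelfandMap B f)] with x hx
      rw [gelfandMap_abs (f := f) rfl, ContinuousMap.abs_apply]
      exact congrArg norm hx
    rw [integral_congr_ae h2, hν]
    exact (integral_congr_ae h1).symm
  let Φ := (LinearEquiv.refl ℝ B).extendOfIsometry B.subtype j hi hj hnorm
  have hΦ : ∀ f : B, Φ f = j f := fun f =>
    LinearEquiv.extendOfIsometry_eq (LinearEquiv.refl ℝ B) B.subtype j hi hj hnorm f
  refine ⟨Φ, ⟨preservesLattice_of_dense hi fun f h => ?_, fun c => ?_⟩, hΦ⟩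
  · have h1 : Φ (B.subtype f ⊔ B.subtype h) = j ⟨(f : Lp ℝ 1 μ) ⊔ h, hB.sup_mem _ f.2 _ h.2⟩ :=
      hΦ ⟨_, _⟩
    have h2 : j ⟨(f : Lp ℝ 1 μ) ⊔ h, hB.sup_mem _ f.2 _ h.2⟩ =
        ContinuousMap.toLp 1 ν ℝ (gelfandMap B f ⊔ gelfandMap B h) :=
      congrArg (ContinuousMap.toLp 1 ν ℝ) (gelfandMap_sup rfl)
    rw [h1, h2]
    change _ = Φ f ⊔ Φ h
    rw [hΦ, hΦ]
    refine Lp.ext ?_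
    filter_upwards [ContinuousMap.coeFn_toLp (p := 1) (𝕜 := ℝ) ν (gelfandMap B f),
      ContinuousMap.coeFn_toLp (p := 1) (𝕜 := ℝ) ν (gelfandMap B h),
      ContinuousMap.coeFn_toLp (p := 1) (𝕜 := ℝ) ν (gelfandMap B f ⊔ gelfandMap B h),
      Lp.coeFn_sup (j f) (j h)] with x h1 h2 h3 h4
    rw [h3, h4, Pi.sup_apply, ContinuousMap.sup_apply]
    exact congrArg₂ _ h1.symm h2.symm
  · refine (hΦ ⟨_, hB.const_mem c⟩).trans (Lp.ext ?_)
    filter_upwards [ContinuousMap.coeFn_toLp (p := 1) (𝕜 := ℝ) ν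
      (gelfandMap B ⟨_, hB.const_mem c⟩), Lp.coeFn_const 1 ν c] with x h1 h2
    rw [h2]
    exact h1.trans (gelfandMap_const hB c x)

end Model

/-! ### The action on the spectrum -/

section Action

variable {X : Type u} [MeasurableSpace X] {μ : Measure X} [IsProbabilityMeasure μ]
  {B : Submodule ℝ (Lp ℝ 1 μ)} {G : Type v} [Group G] [TopologicalSpace G]
  {σ : G →* (Lp ℝ 1 μ ≃ₗᵢ[ℝ] Lp ℝ 1 μ)}

/-- `B` is invariant under `σ`, and the orbit maps of its elements are continuous at the identity
for the norm of `L^∞`, expressed here by order intervals of constants in `L^1`. -/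
structure IsUniformlyContinuousSubspace (σ : G →* (Lp ℝ 1 μ ≃ₗᵢ[ℝ] Lp ℝ 1 μ))
    (B : Submodule ℝ (Lp ℝ 1 μ)) : Prop where
  map_mem : ∀ g, ∀ f ∈ B, σ g f ∈ B
  continuous : ∀ f ∈ B, ∀ ε : ℝ, 0 < ε → ∀ᶠ g in 𝓝 (1 : G), |σ g f - f| ≤ Lp.const 1 μ ε

/-- The action `(g • x) f = x (σ g⁻¹ f)` of `G` on the spectrum of an invariant sublattice. -/
@[reducible]
def latticeSpectrumAction (hσ : IsStronglyContinuousLatticeRep σ)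
    (hB : IsUniformlyContinuousSubspace σ B) : MulAction G (LatticeSpectrum B) where
  smul g x := ⟨fun f => x.1 ⟨σ g⁻¹ f, hB.map_mem _ f f.2⟩,
    { map_add := fun f h => by
        rw [← x.2.map_add]
        exact congrArg x.1 (Subtype.ext (map_add (σ g⁻¹) (f : Lp ℝ 1 μ) h))
      map_smul := fun c f => by
        rw [← x.2.map_smul]
        exact congrArg x.1 (Subtype.ext (map_smul (σ g⁻¹) c (f : Lp ℝ 1 μ)))
      map_sup := fun f h k hk => by
        exact x.2.map_sup _ _ _
          ((congrArg (σ g⁻¹) hk).trans ((hσ.lattice g⁻¹).map_sup _ _))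
      map_one := fun k hk => by
        exact x.2.map_one _ ((congrArg (σ g⁻¹) hk).trans (hσ.fixes_const _ _)) }⟩
  one_smul x := Subtype.ext (funext fun f => congrArg x.1 (Subtype.ext (by
    change σ 1⁻¹ (f : Lp ℝ 1 μ) = f
    rw [inv_one, map_one, LinearIsometryEquiv.coe_one, id])))
  mul_smul g h x := Subtype.ext (funext fun f => congrArg x.1 (Subtype.ext (by
    change σ (g * h)⁻¹ (f : Lp ℝ 1 μ) = σ h⁻¹ (σ g⁻¹ f)
    rw [mul_inv_rev, map_mul, LinearIsometryEquiv.coe_mul, Function.comp_apply])))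

theorem IsUniformlyContinuousSubspace.eventually_abs_sub_le [IsTopologicalGroup G]
    (hσ : IsStronglyContinuousLatticeRep σ) (hB : IsUniformlyContinuousSubspace σ B)
    {f : Lp ℝ 1 μ} (hf : f ∈ B) (g₀ : G) {ε : ℝ} (hε : 0 < ε) :
    ∀ᶠ g in 𝓝 g₀, |σ g f - σ g₀ f| ≤ Lp.const 1 μ ε := by
  have ht : Tendsto (fun g : G => g₀⁻¹ * g) (𝓝 g₀) (𝓝 1) := by
    have : Continuous fun g : G => g₀⁻¹ * g := by fun_prop
    simpa using this.tendsto g₀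
  filter_upwards [ht.eventually (hB.continuous f hf ε hε)] with g hg
  have := (hσ.isUnitalLatticeMap g₀).abs_le_const hg
  rwa [map_sub, ← Function.comp_apply (f := σ g₀), ← LinearIsometryEquiv.coe_mul, ← map_mul,
    mul_inv_cancel_left] at this

theorem continuousSMul_latticeSpectrumAction [IsTopologicalGroup G]
    (hσ : IsStronglyContinuousLatticeRep σ)
    (hB : IsUniformlyContinuousSubspace σ B) (hB' : IsUnitalBoundedSublattice B) :
    let := latticeSpectrumAction hσ hB
    ContinuousSMul G (LatticeSpectrum B) := by
  have key : ∀ f : B, Continuous fun p : G × LatticeSpectrum B =>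
      p.2.1 ⟨σ p.1⁻¹ f, hB.map_mem _ f f.2⟩ := by
    intro f
    refine continuous_iff_continuousAt.2 fun ⟨g₀, x₀⟩ => Metric.tendsto_nhds.2 fun ε hε => ?_
    have hg : ∀ᶠ g in 𝓝 g₀, |σ g⁻¹ (f : Lp ℝ 1 μ) - σ g₀⁻¹ f| ≤ Lp.const 1 μ (ε / 2) :=
      (continuous_inv.tendsto g₀).eventually
        (hB.eventually_abs_sub_le hσ f.2 g₀⁻¹ (half_pos hε))
    have hx : ∀ᶠ x : LatticeSpectrum B in 𝓝 x₀, |x.1 ⟨σ g₀⁻¹ f, hB.map_mem _ f f.2⟩ -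
        x₀.1 ⟨σ g₀⁻¹ f, hB.map_mem _ f f.2⟩| < ε / 2 :=
      Metric.tendsto_nhds.1
        ((gelfandMap B ⟨σ g₀⁻¹ f, hB.map_mem _ f f.2⟩).continuous.tendsto x₀)
        (ε / 2) (half_pos hε)
    have hgx : ∀ᶠ p : G × LatticeSpectrum B in 𝓝 (g₀, x₀), _ ∧ _ := hg.prod_nhds hx
    filter_upwards [hgx] with p hp
    have h1 := p.2.2.abs_sub_le hB' (f := ⟨σ p.1⁻¹ f, hB.map_mem _ f f.2⟩)
      (h := ⟨σ g₀⁻¹ f, hB.map_mem _ f f.2⟩) hp.1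
    rw [Real.dist_eq]
    have h2 := abs_sub_le (p.2.1 ⟨σ p.1⁻¹ f, hB.map_mem _ f f.2⟩)
      (p.2.1 ⟨σ g₀⁻¹ f, hB.map_mem _ f f.2⟩) (x₀.1 ⟨σ g₀⁻¹ f, hB.map_mem _ f f.2⟩)
    have h3 := hp.2
    linarith
  intro _
  exact ⟨Continuous.subtype_mk (continuous_pi key) _⟩

/-- The topological model on the spectrum of an invariant dense sublattice, at the level of
`L^1`. -/
theorem exists_topologicalModel_one [IsTopologicalGroup G]
    (hσ : IsStronglyContinuousLatticeRep σ) (hB : IsUniformlyContinuousSubspace σ B)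
    (hB' : IsUnitalBoundedSublattice B) (hd : Dense (B : Set (Lp ℝ 1 μ))) :
    ∃ (_ : CompactSpace (LatticeSpectrum B)) (_ : MulAction G (LatticeSpectrum B))
      (_ : ContinuousSMul G (LatticeSpectrum B)) (_ : MeasurableSpace (LatticeSpectrum B))
      (_ : BorelSpace (LatticeSpectrum B)) (ν : Measure (LatticeSpectrum B))
      (_ : IsProbabilityMeasure ν) (_ : ν.Regular)
      (_ : SMulInvariantMeasure G (LatticeSpectrum B) ν)
      (Φ : Lp ℝ 1 μ ≃ₗᵢ[ℝ] Lp ℝ 1 ν), ν.support = Set.univ ∧ IsUnitalLatticeMap Φ ∧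
        ∀ g f, Φ (σ g f) = canonicalRep ν 1 g (Φ f) := by
  have := compactSpace_latticeSpectrum hB'
  let := latticeSpectrumAction hσ hB
  have hsmul : ∀ (g : G) (x : LatticeSpectrum B) (f : B),
      gelfandMap B f (g • x) = gelfandMap B ⟨σ g⁻¹ f, hB.map_mem _ f f.2⟩ x := fun _ _ _ => rfl
  have := continuousSMul_latticeSpectrumAction hσ hB hB'
  borelize (LatticeSpectrum B)
  obtain ⟨ν, hreg, hprob, hν⟩ := exists_measure_latticeSpectrum hB'
  have hinv : SMulInvariantMeasure G (LatticeSpectrum B) ν := by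
    refine ⟨fun g s hs => ?_⟩
    have hreg' : (ν.map (g • ·)).Regular := Measure.Regular.map (Homeomorph.smul g)
    have hmap : ν.map (g • ·) = ν := by
      refine Measure.ext_of_integral_eq_on_dense (denseRange_gelfandMap hB') fun f => ?_
      rw [integral_map (by fun_prop) (gelfandMap B f).continuous.aestronglyMeasurable]
      simp_rw [hsmul]
      rw [hν, hν]
      exact ((hσ.isUnitalLatticeMap g⁻¹).identDistrib ENNReal.one_ne_top _).integral_eq
    rw [← Measure.map_apply (by fun_prop) hs, hmap]
  obtain ⟨Φ, hΦ, hΦB⟩ := exists_unitalLatticeIsometry_latticeSpectrum hB' hd hν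
  refine ⟨inferInstance, inferInstance, inferInstance, inferInstance, inferInstance, ν, hprob, hreg,
    hinv, Φ, support_eq_univ_of_integral_gelfandMap hB' hν, hΦ, fun g f => ?_⟩
  refine congrFun (Continuous.ext_on (f := fun f => Φ (σ g f))
    (g := fun f => canonicalRep ν 1 g (Φ f)) hd (Φ.continuous.comp (σ g).continuous)
    ((canonicalRep ν 1 g).continuous.comp Φ.continuous) fun f hf => ?_) f
  have h1 : Φ (σ g f) = ContinuousMap.toLp 1 ν ℝ (gelfandMap B ⟨σ g f, hB.map_mem _ f hf⟩) :=
    hΦB ⟨σ g f, _⟩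
  have h2 : Φ f = ContinuousMap.toLp 1 ν ℝ (gelfandMap B ⟨f, hf⟩) := hΦB ⟨f, hf⟩
  refine Lp.ext ?_
  dsimp only
  rw [h1, h2]
  refine (ContinuousMap.coeFn_toLp ν _).trans
    (EventuallyEq.trans ?_ (canonicalRep_ae ν 1 g _).symm)
  have h3 := (measurePreserving_smul g⁻¹ ν).quasiMeasurePreserving.ae_eq_comp
    (ContinuousMap.coeFn_toLp (p := 1) (𝕜 := ℝ) ν (gelfandMap B ⟨f, hf⟩))
  filter_upwards [h3] with x hx
  refine Eq.trans ?_ hx.symm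
  simp only [Function.comp_apply, hsmul, inv_inv]

end Action

/-! ### Passage to all exponents -/

section AllExponents

variable {X : Type*} [MeasurableSpace X] {μ : Measure X} [IsProbabilityMeasure μ]
  {G : Type*} [Group G] {K : Type*} [MeasurableSpace K] {ν : Measure K} [IsProbabilityMeasure ν]

theorem canonicalRep_lpInclusion [MulAction G K] [MeasurableConstSMul G K]
    [SMulInvariantMeasure G K ν] {p q : ℝ≥0∞} [Fact (1 ≤ p)] [Fact (1 ≤ q)] (hpq : p ≤ q) (g : G)
    (f : Lp ℝ q ν) :
    canonicalRep ν p g (lpInclusion ν hpq f) = lpInclusion ν hpq (canonicalRep ν q g f) :=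
  Lp.ext ((canonicalRep_ae ν p g _).trans (canonicalRep_ae ν q g f).symm)

/-- A representation that is conjugate under a unital lattice isometry to a strongly continuous
representation by unital lattice isometries is of the same kind. -/
theorem IsStronglyContinuousLatticeRep.of_conj [TopologicalSpace G] {p : ℝ≥0∞} [Fact (1 ≤ p)]
    {ρ : G →* (Lp ℝ p μ ≃ₗᵢ[ℝ] Lp ℝ p μ)} (hρ : IsStronglyContinuousLatticeRep ρ)
    {τ : G →* (Lp ℝ p ν ≃ₗᵢ[ℝ] Lp ℝ p ν)} {Φ : Lp ℝ p μ ≃ₗᵢ[ℝ] Lp ℝ p ν}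
    (hΦ : IsUnitalLatticeMap Φ) (h : ∀ g f, Φ (ρ g f) = τ g (Φ f)) :
    IsStronglyContinuousLatticeRep τ := by
  have hτ : ∀ g f, τ g f = Φ (ρ g (Φ.symm f)) := fun g f => by rw [h, Φ.apply_symm_apply]
  refine ⟨fun g => ⟨fun f f' => ?_, fun f f' => ?_⟩, fun g c => ?_, fun f => ?_⟩
  · rw [hτ, hτ, hτ, hΦ.symm.map_sup, (hρ.lattice g).map_sup, hΦ.map_sup]
  · rw [hτ, hτ, hτ, hΦ.symm.map_inf, (hρ.lattice g).map_inf, hΦ.map_inf]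
  · rw [hτ, hΦ.symm.map_const, hρ.fixes_const, hΦ.map_const]
  · simp_rw [hτ]
    exact Φ.continuous.comp (hρ.continuous _)

/-- An equivariant unital lattice isometry of `L^1`-spaces restricts to compatible equivariant
isometries of all the `L^p`-spaces. -/
theorem exists_equivariant_family [TopologicalSpace G] [MulAction G K]
    [MeasurableConstSMul G K] [SMulInvariantMeasure G K ν] {p₀ : FiniteExponent}
    {ρ₀ : G →* (Lp ℝ (p₀ : ℝ≥0∞) μ ≃ₗᵢ[ℝ] Lp ℝ (p₀ : ℝ≥0∞) μ)}
    {ρ : ∀ p : FiniteExponent, G →* (Lp ℝ (p : ℝ≥0∞) μ ≃ₗᵢ[ℝ] Lp ℝ (p : ℝ≥0∞) μ)}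
    (hρ : IsNaturalFamily ρ₀ ρ) {σ : G →* (Lp ℝ 1 μ ≃ₗᵢ[ℝ] Lp ℝ 1 μ)}
    (hσ : ρ FiniteExponent.one = σ) {Φ₁ : Lp ℝ 1 μ ≃ₗᵢ[ℝ] Lp ℝ 1 ν} (hΦ₁ : IsUnitalLatticeMap Φ₁)
    (h₁ : ∀ g f, Φ₁ (σ g f) = canonicalRep ν 1 g (Φ₁ f)) :
    ∃ Φ : ∀ p : FiniteExponent, Lp ℝ (p : ℝ≥0∞) μ ≃ₗᵢ[ℝ] Lp ℝ (p : ℝ≥0∞) ν,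
      (∀ p : FiniteExponent, PreservesLattice (Φ p)) ∧
      (∀ p : FiniteExponent, Φ p (Lp.const p μ 1) = Lp.const p ν 1) ∧
      (∀ (p q : FiniteExponent) (hpq : (p : ℝ≥0∞) ≤ q) (f : Lp ℝ (q : ℝ≥0∞) μ),
        Φ p (lpInclusion μ hpq f) = lpInclusion ν hpq (Φ q f)) ∧
      (∀ p : FiniteExponent,
        IsStronglyContinuousLatticeRep (canonicalRep (G := G) ν (p : ℝ≥0∞))) ∧
      (∀ (p : FiniteExponent) (g : G) (f : Lp ℝ (p : ℝ≥0∞) μ),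
        Φ p (ρ p g f) = canonicalRep ν (p : ℝ≥0∞) g (Φ p f)) := by
  choose Φ hΦ hΦ₁ using fun p : FiniteExponent =>
    hΦ₁.exists_restriction (p := (p : ℝ≥0∞)) ENNReal.one_ne_top p.2.1
  have heq : ∀ (p : FiniteExponent) (g : G) (f : Lp ℝ (p : ℝ≥0∞) μ),
      Φ p (ρ p g f) = canonicalRep ν (p : ℝ≥0∞) g (Φ p f) := by
    intro p g f
    apply lpInclusion_injective p.2.1
    rw [← canonicalRep_lpInclusion, hΦ₁, hΦ₁, ← h₁]
    rw [← hσ]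
    exact congrArg Φ₁ (hρ.compatible FiniteExponent.one p p.2.1 g f).symm
  refine ⟨Φ, fun p => (hΦ p).toPreservesLattice, fun p => (hΦ p).map_const 1,
    fun p q hpq f => ?_, fun p => (hρ.rep p).of_conj (hΦ p) (heq p), heq⟩
  apply lpInclusion_injective p.2.1
  rw [hΦ₁]
  exact (hΦ₁ q f).symm

end AllExponents

/-! ### Vectors with uniformly continuous orbits -/

section UniformlyContinuousVectors

variable {X : Type u} [MeasurableSpace X] {μ : Measure X} [IsProbabilityMeasure μ]
  {G : Type v} [Group G] [TopologicalSpace G]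
  {σ : G →* (Lp ℝ 1 μ ≃ₗᵢ[ℝ] Lp ℝ 1 μ)}

theorem abs_sup_sub_sup_le_add {E : Type*} [Lattice E] [AddCommGroup E] [IsOrderedAddMonoid E]
    (a b a' b' : E) : |a ⊔ b - a' ⊔ b'| ≤ |a - a'| + |b - b'| := by
  have h := abs_add_le (a ⊔ b - a' ⊔ b) (a' ⊔ b - a' ⊔ b')
  rw [sub_add_sub_cancel] at h
  refine h.trans (add_le_add (abs_sup_sub_sup_le_abs _ _ _) ?_)
  rw [sup_comm a', sup_comm a']
  exact abs_sup_sub_sup_le_abs _ _ _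

theorem Lp.abs_smul_le_const {f : Lp ℝ 1 μ} {c : ℝ} (hf : |f| ≤ Lp.const 1 μ c) (a : ℝ) :
    |a • f| ≤ Lp.const 1 μ (|a| * c) := by
  rw [Lp.abs_le_const_iff] at hf ⊢
  filter_upwards [hf, Lp.coeFn_smul a f] with x h1 h2
  rw [h2, Pi.smul_apply, smul_eq_mul, abs_mul]
  exact mul_le_mul_of_nonneg_left h1 (abs_nonneg a)

variable (σ) in
/-- The bounded elements of `L^1` whose orbit maps are continuous at the identity for the norm of
`L^∞`. -/
def uniformlyContinuousVectors : Submodule ℝ (Lp ℝ 1 μ) where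
  carrier := {f | Lp.IsBounded f ∧
    ∀ ε : ℝ, 0 < ε → ∀ᶠ g in 𝓝 (1 : G), |σ g f - f| ≤ Lp.const 1 μ ε}
  zero_mem' := by
    refine ⟨⟨0, ?_⟩, fun ε hε => Eventually.of_forall fun g => ?_⟩
    · rw [abs_zero, map_zero]
    · rw [map_zero, sub_zero, abs_zero, ← map_zero (Lp.const 1 μ)]
      exact Lp.const_le_const 1 hε.le
  add_mem' := by
    rintro f h ⟨⟨c, hc⟩, hf⟩ ⟨⟨d, hd⟩, hh⟩
    refine ⟨⟨c + d, ?_⟩, fun ε hε => ?_⟩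
    · rw [map_add]
      exact (abs_add_le _ _).trans (add_le_add hc hd)
    · filter_upwards [hf _ (half_pos hε), hh _ (half_pos hε)] with g h1 h2
      rw [map_add, add_sub_add_comm, ← add_halves ε, map_add]
      exact (abs_add_le _ _).trans (add_le_add h1 h2)
  smul_mem' := by
    rintro a f ⟨⟨c, hc⟩, hf⟩
    refine ⟨⟨_, Lp.abs_smul_le_const hc a⟩, fun ε hε => ?_⟩
    filter_upwards [hf (ε / (|a| + 1)) (by positivity)] with g hg
    rw [map_smul, ← smul_sub]
    refine (Lp.abs_smul_le_const hg a).trans (Lp.const_le_const 1 ?_)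
    rw [mul_div_assoc', div_le_iff₀ (by positivity)]
    nlinarith [abs_nonneg a]

theorem isUnitalBoundedSublattice_uniformlyContinuousVectors
    (hσ : IsStronglyContinuousLatticeRep σ) :
    IsUnitalBoundedSublattice (uniformlyContinuousVectors σ) where
  sup_mem := by
    rintro f ⟨⟨c, hc⟩, hf⟩ h ⟨⟨d, hd⟩, hh⟩
    refine ⟨⟨c + d, ?_⟩, fun ε hε => ?_⟩
    · have := abs_sup_sub_sup_le_add f h 0 0
      rw [sup_idem, sub_zero, sub_zero, sub_zero] at this
      rw [map_add]
      exact this.trans (add_le_add hc hd)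
    · filter_upwards [hf _ (half_pos hε), hh _ (half_pos hε)] with g h1 h2
      rw [(hσ.lattice g).map_sup, ← add_halves ε, map_add]
      exact (abs_sup_sub_sup_le_add _ _ _ _).trans (add_le_add h1 h2)
  one_mem := by
    refine ⟨⟨1, ?_⟩, fun ε hε => Eventually.of_forall fun g => ?_⟩
    · refine (abs_of_nonneg ?_).le
      rw [← map_zero (Lp.const 1 μ)]
      exact Lp.const_le_const 1 zero_le_one
    · rw [hσ.fixes_const, sub_self, abs_zero, ← map_zero (Lp.const 1 μ)]
      exact Lp.const_le_const 1 hε.le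
  bounded f hf := hf.1

theorem isUniformlyContinuousSubspace_uniformlyContinuousVectors [IsTopologicalGroup G]
    (hσ : IsStronglyContinuousLatticeRep σ) :
    IsUniformlyContinuousSubspace σ (uniformlyContinuousVectors σ) where
  map_mem := by
    rintro g f ⟨⟨c, hc⟩, hf⟩
    refine ⟨⟨c, (hσ.isUnitalLatticeMap g).abs_le_const hc⟩, fun ε hε => ?_⟩
    have ht : Tendsto (fun h : G => g⁻¹ * h * g) (𝓝 1) (𝓝 1) := by
      have : Continuous fun h : G => g⁻¹ * h * g := by fun_prop
      simpa using this.tendsto 1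
    filter_upwards [ht.eventually (hf ε hε)] with h hh
    have := (hσ.isUnitalLatticeMap g).abs_le_const hh
    rwa [map_sub, ← Function.comp_apply (f := σ g), ← LinearIsometryEquiv.coe_mul, ← map_mul,
      mul_assoc, mul_inv_cancel_left, map_mul] at this
  continuous f hf := hf.2

section Smoothing

variable [IsTopologicalGroup G] [LocallyCompactSpace G] [MeasurableSpace G] [BorelSpace G]

theorem integrable_smul_orbit (hσ : IsStronglyContinuousLatticeRep σ) {ψ : G → ℝ}
    (hψ : Continuous ψ) (hs : HasCompactSupport ψ) (f : Lp ℝ 1 μ) :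
    Integrable (fun g => ψ g • σ g f) Measure.haar :=
  (hψ.smul (hσ.continuous f)).integrable_of_hasCompactSupport hs.smul_right

theorem integral_smul_orbit_le (hσ : IsStronglyContinuousLatticeRep σ) {ψ : G → ℝ}
    (hψ : Continuous ψ) (hs : HasCompactSupport ψ) {f : Lp ℝ 1 μ} {c : ℝ}
    (hf : |f| ≤ Lp.const 1 μ c) :
    ∫ g, ψ g • σ g f ∂Measure.haar ≤ Lp.const 1 μ ((∫ g, |ψ g| ∂Measure.haar) * c) := by
  have hi : Integrable (fun g => |ψ g|) Measure.haar :=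
    (hψ.integrable_of_hasCompactSupport hs).abs
  have hle : ∀ g, ψ g • σ g f ≤ |ψ g| • Lp.const 1 μ c := by
    intro g
    have hg := (hσ.isUnitalLatticeMap g).abs_le_const hf
    rcases le_total 0 (ψ g) with h | h
    · rw [abs_of_nonneg h]
      exact smul_le_smul_of_nonneg_left ((le_abs_self _).trans hg) h
    · rw [abs_of_nonpos h, ← neg_smul_neg]
      exact smul_le_smul_of_nonneg_left ((neg_le_abs _).trans hg) (neg_nonneg.2 h)
  refine (integral_mono (integrable_smul_orbit hσ hψ hs f) (hi.smul_const _) hle).trans_eq ?_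
  rw [integral_smul_const, Lp.const_eq_smul 1 c, smul_smul, ← Lp.const_eq_smul]

theorem abs_integral_smul_orbit_le (hσ : IsStronglyContinuousLatticeRep σ) {ψ : G → ℝ}
    (hψ : Continuous ψ) (hs : HasCompactSupport ψ) {f : Lp ℝ 1 μ} {c : ℝ}
    (hf : |f| ≤ Lp.const 1 μ c) :
    |∫ g, ψ g • σ g f ∂Measure.haar| ≤ Lp.const 1 μ ((∫ g, |ψ g| ∂Measure.haar) * c) := by
  refine sup_le (integral_smul_orbit_le hσ hψ hs hf) ?_
  have := integral_smul_orbit_le hσ hψ hs (f := -f) (by rwa [abs_neg])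
  simpa only [map_neg, smul_neg, integral_neg] using this

open scoped Pointwise in
/-- Left translation of a compactly supported continuous function is continuous for the norm of
`L^1(G)`. -/
theorem tendsto_integral_abs_translate_sub {φ : G → ℝ} (hφ : Continuous φ)
    (hs : HasCompactSupport φ) :
    Tendsto (fun h : G => ∫ g, |φ (h⁻¹ * g) - φ g| ∂Measure.haar) (𝓝 1) (𝓝 0) := by
  obtain ⟨V, hVc, hV⟩ := exists_compact_mem_nhds (1 : G)
  have hcont : ContinuousOn (fun h : G => ∫ g, |φ (h⁻¹ * g) - φ g| ∂Measure.haar) V := by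
    refine continuousOn_integral_of_compact_support (k := (V * tsupport φ) ∪ tsupport φ)
      ((hVc.mul hs).union hs) ?_ ?_
    · refine Continuous.continuousOn ?_
      have : Continuous fun p : G × G => |φ (p.1⁻¹ * p.2) - φ p.2| := by fun_prop
      exact this
    · intro h g hh hg
      have h1 : φ g = 0 := image_eq_zero_of_notMem_tsupport fun h' => hg (Or.inr h')
      have h2 : φ (h⁻¹ * g) = 0 := image_eq_zero_of_notMem_tsupport fun h' =>
        hg (Or.inl ⟨h, hh, h⁻¹ * g, h', mul_inv_cancel_left h g⟩)
      rw [h1, h2, sub_zero, abs_zero]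
  have := (hcont.continuousAt hV).tendsto
  simpa using this

theorem integral_smul_orbit_mem (hσ : IsStronglyContinuousLatticeRep σ) {φ : G → ℝ}
    (hφ : Continuous φ) (hs : HasCompactSupport φ) {f : Lp ℝ 1 μ} (hf : Lp.IsBounded f) :
    ∫ g, φ g • σ g f ∂Measure.haar ∈ uniformlyContinuousVectors σ := by
  obtain ⟨c, hc⟩ := hf
  have hst : ∀ h : G, HasCompactSupport fun g => φ (h⁻¹ * g) := fun h =>
    hs.comp_homeomorph (Homeomorph.mulLeft h⁻¹)
  have hsub : ∀ h : G, HasCompactSupport fun g => φ (h⁻¹ * g) - φ g := fun h => (hst h).sub hs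
  refine ⟨⟨_, abs_integral_smul_orbit_le hσ hφ hs hc⟩, fun ε hε => ?_⟩
  have htrans : ∀ h : G, σ h (∫ g, φ g • σ g f ∂Measure.haar) - ∫ g, φ g • σ g f ∂Measure.haar =
      ∫ g, (φ (h⁻¹ * g) - φ g) • σ g f ∂Measure.haar := by
    intro h
    have h1 : σ h (∫ g, φ g • σ g f ∂Measure.haar) =
        ∫ g, φ (h⁻¹ * g) • σ g f ∂Measure.haar := by
      rw [← integral_mul_left_eq_self (fun g => φ (h⁻¹ * g) • σ g f) h]
      refine ((σ h).toContinuousLinearEquiv.toContinuousLinearMap.integral_comp_comm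
        (integrable_smul_orbit hσ hφ hs f)).symm.trans (integral_congr_ae (ae_of_all _ fun g => ?_))
      change σ h (φ g • σ g f) = φ (h⁻¹ * (h * g)) • σ (h * g) f
      rw [inv_mul_cancel_left, map_mul, map_smul, LinearIsometryEquiv.coe_mul, Function.comp_apply]
    rw [h1, ← integral_sub (integrable_smul_orbit hσ (by fun_prop) (hst h) f)
      (integrable_smul_orbit hσ hφ hs f)]
    simp_rw [sub_smul]
  have hev := (tendsto_integral_abs_translate_sub hφ hs).eventually
    (gt_mem_nhds (show 0 < ε / (|c| + 1) by positivity))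
  filter_upwards [hev] with h hh
  rw [htrans]
  refine (abs_integral_smul_orbit_le hσ (by fun_prop) (hsub h) hc).trans (Lp.const_le_const 1 ?_)
  have h0 : 0 ≤ ∫ g, |φ (h⁻¹ * g) - φ g| ∂Measure.haar := integral_nonneg fun g => abs_nonneg _
  rw [lt_div_iff₀ (by positivity)] at hh
  nlinarith [le_abs_self c]

end Smoothing

/-- The vectors with uniformly continuous orbits are dense: they contain the averages
`∫ φ(g) σ(g) f dg` of bounded functions, which are close to `f` if `φ` is concentrated near the
identity. -/
theorem dense_uniformlyContinuousVectors [IsTopologicalGroup G] [LocallyCompactSpace G]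
    (hσ : IsStronglyContinuousLatticeRep σ) :
    Dense (uniformlyContinuousVectors σ : Set (Lp ℝ 1 μ)) := by
  borelize G
  refine dense_closure.1 ((Lp.dense_isBounded ENNReal.one_ne_top).mono fun f hf =>
    Metric.mem_closure_iff.2 fun ε hε => ?_)
  have hU : IsOpen {g : G | ‖σ g f - f‖ < ε / 2} :=
    isOpen_lt ((hσ.continuous f).sub continuous_const).norm continuous_const
  have h1U : (1 : G) ∈ {g : G | ‖σ g f - f‖ < ε / 2} := by
    simp [half_pos hε]
  obtain ⟨φ, h1, h0, hs, h01⟩ := exists_continuous_one_zero_of_isCompact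
    (isCompact_singleton (x := (1 : G))) hU.isClosed_compl
    (Set.disjoint_compl_right_iff_subset.2 (Set.singleton_subset_iff.2 h1U))
  have hpos : 0 < ∫ g, φ g ∂Measure.haar :=
    φ.continuous.integral_pos_of_hasCompactSupport_nonneg_nonzero hs (fun g => (h01 g).1)
      (x := 1) (by rw [h1 rfl]; exact one_ne_zero)
  set I := ∫ g, φ g ∂Measure.haar
  have hint := φ.continuous.integrable_of_hasCompactSupport (μ := Measure.haar) hs
  refine ⟨I⁻¹ • ∫ g, φ g • σ g f ∂Measure.haar,
    Submodule.smul_mem _ _ (integral_smul_orbit_mem hσ φ.continuous hs hf), ?_⟩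
  have hf' : f = I⁻¹ • ∫ g, φ g • f ∂Measure.haar := by
    rw [integral_smul_const, smul_smul, inv_mul_cancel₀ hpos.ne', one_smul]
  have hle : ‖∫ g, φ g • (σ g f - f) ∂Measure.haar‖ ≤ I * (ε / 2) := by
    rw [← integral_mul_const]
    refine norm_integral_le_of_norm_le (hint.mul_const _) (ae_of_all _ fun g => ?_)
    rw [norm_smul, Real.norm_of_nonneg (h01 g).1]
    by_cases hg : g ∈ {g : G | ‖σ g f - f‖ < ε / 2}
    · exact mul_le_mul_of_nonneg_left (le_of_lt hg) (h01 g).1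
    · rw [h0 hg, Pi.zero_apply, zero_mul, zero_mul]
  rw [dist_comm, dist_eq_norm]
  calc ‖I⁻¹ • ∫ g, φ g • σ g f ∂Measure.haar - f‖
      = ‖I⁻¹ • ∫ g, φ g • (σ g f - f) ∂Measure.haar‖ := by
        conv_lhs => rw [hf']
        simp_rw [smul_sub]
        rw [integral_sub (integrable_smul_orbit hσ φ.continuous hs f) (hint.smul_const f), smul_sub]
        rw [← hf']
    _ ≤ I⁻¹ * (I * (ε / 2)) := by
        rw [norm_smul, Real.norm_of_nonneg (inv_nonneg.2 hpos.le)]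
        exact mul_le_mul_of_nonneg_left hle (inv_nonneg.2 hpos.le)
    _ = ε / 2 := by rw [inv_mul_cancel_left₀ hpos.ne']
    _ < ε := half_lt_self hε

end UniformlyContinuousVectors

/-! ### Metrizability -/

section Metrizable

variable {X : Type u} [MeasurableSpace X] {μ : Measure X} [IsProbabilityMeasure μ]
  {G : Type v} [Group G] [TopologicalSpace G]
  {σ : G →* (Lp ℝ 1 μ ≃ₗᵢ[ℝ] Lp ℝ 1 μ)}

/-- Membership in the smallest linear subspace of `L^1` that contains `S` and the constants and is
closed under suprema. -/
inductive MemLatticeSpan (S : Set (Lp ℝ 1 μ)) : Lp ℝ 1 μ → Prop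
  | of {f : Lp ℝ 1 μ} (hf : f ∈ S) : MemLatticeSpan S f
  | one : MemLatticeSpan S (Lp.const 1 μ (1 : ℝ))
  | add {f h : Lp ℝ 1 μ} (hf : MemLatticeSpan S f) (hh : MemLatticeSpan S h) :
      MemLatticeSpan S (f + h)
  | smul (c : ℝ) {f : Lp ℝ 1 μ} (hf : MemLatticeSpan S f) : MemLatticeSpan S (c • f)
  | sup {f h : Lp ℝ 1 μ} (hf : MemLatticeSpan S f) (hh : MemLatticeSpan S h) :
      MemLatticeSpan S (f ⊔ h)

/-- The smallest linear subspace of `L^1` that contains `S` and the constants and is closed under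
suprema. -/
def latticeSpan (S : Set (Lp ℝ 1 μ)) : Submodule ℝ (Lp ℝ 1 μ) where
  carrier := {f | MemLatticeSpan S f}
  zero_mem' := by simpa using MemLatticeSpan.smul (S := S) 0 MemLatticeSpan.one
  add_mem' := MemLatticeSpan.add
  smul_mem' c _ := MemLatticeSpan.smul c

theorem subset_latticeSpan (S : Set (Lp ℝ 1 μ)) : S ⊆ latticeSpan S := fun _ => MemLatticeSpan.of

theorem latticeSpan_le {S : Set (Lp ℝ 1 μ)} {A : Submodule ℝ (Lp ℝ 1 μ)}
    (hA : IsUnitalBoundedSublattice A) (hS : S ⊆ A) : latticeSpan S ≤ A := by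
  intro f hf
  induction hf with
  | of hf => exact hS hf
  | one => exact hA.one_mem
  | add _ _ h1 h2 => exact A.add_mem h1 h2
  | smul c _ h => exact A.smul_mem c h
  | sup _ _ h1 h2 => exact hA.sup_mem _ h1 _ h2

theorem isUnitalBoundedSublattice_latticeSpan {S : Set (Lp ℝ 1 μ)} {A : Submodule ℝ (Lp ℝ 1 μ)}
    (hA : IsUnitalBoundedSublattice A) (hS : S ⊆ A) :
    IsUnitalBoundedSublattice (latticeSpan S) where
  sup_mem _ hf _ hh := MemLatticeSpan.sup hf hh
  one_mem := MemLatticeSpan.one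
  bounded f hf := hA.bounded f (latticeSpan_le hA hS hf)

theorem isUniformlyContinuousSubspace_latticeSpan (hσ : IsStronglyContinuousLatticeRep σ)
    {S : Set (Lp ℝ 1 μ)} {A : Submodule ℝ (Lp ℝ 1 μ)} (hA : IsUnitalBoundedSublattice A)
    (hA' : IsUniformlyContinuousSubspace σ A) (hS : S ⊆ A) (hinv : ∀ g, ∀ f ∈ S, σ g f ∈ S) :
    IsUniformlyContinuousSubspace σ (latticeSpan S) where
  map_mem g f hf := by
    induction hf with
    | of hf => exact MemLatticeSpan.of (hinv g _ hf)
    | one => exact (hσ.fixes_const g 1).symm ▸ MemLatticeSpan.one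
    | add _ _ h1 h2 => exact (map_add (σ g) _ _).symm ▸ MemLatticeSpan.add h1 h2
    | smul c _ h => exact (map_smul (σ g) c _).symm ▸ MemLatticeSpan.smul c h
    | sup _ _ h1 h2 => exact ((hσ.lattice g).map_sup _ _).symm ▸ MemLatticeSpan.sup h1 h2
  continuous f hf := hA'.continuous f (latticeSpan_le hA hS hf)

/-- Lattice characters on `latticeSpan S` are determined by their values on `S`. -/
theorem latticeSpectrum_ext_of_latticeSpan {S : Set (Lp ℝ 1 μ)}
    {x y : LatticeSpectrum (latticeSpan S)}
    (h : ∀ f (hf : f ∈ S), x.1 ⟨f, subset_latticeSpan S hf⟩ = y.1 ⟨f, subset_latticeSpan S hf⟩) :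
    x = y := by
  have key : ∀ f (hf : MemLatticeSpan S f), x.1 ⟨f, hf⟩ = y.1 ⟨f, hf⟩ := by
    intro f hf
    induction hf with
    | of hf => exact h _ hf
    | one => rw [x.2.map_one _ rfl, y.2.map_one _ rfl]
    | @add f k hf hk h1 h2 =>
      exact (x.2.map_add ⟨f, hf⟩ ⟨k, hk⟩).trans
        ((congrArg₂ _ h1 h2).trans (y.2.map_add ⟨f, hf⟩ ⟨k, hk⟩).symm)
    | @smul c f hf h1 =>
      exact (x.2.map_smul c ⟨f, hf⟩).trans
        ((congrArg _ h1).trans (y.2.map_smul c ⟨f, hf⟩).symm)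
    | @sup f k hf hk h1 h2 =>
      exact (x.2.map_sup ⟨f, hf⟩ ⟨k, hk⟩ _ rfl).trans
        ((congrArg₂ _ h1 h2).trans (y.2.map_sup ⟨f, hf⟩ ⟨k, hk⟩ _ rfl).symm)
  exact Subtype.ext (funext fun f => key f.1 f.2)

/-- If `G` is `σ`-compact, then the orbits of countably many vectors with uniformly continuous
orbits generate a sublattice with metrizable spectrum: countably many points of the orbits, dense
for the norm of `L^∞`, suffice to separate the lattice characters. -/
theorem metrizableSpace_latticeSpectrum_latticeSpan [IsTopologicalGroup G] [SigmaCompactSpace G]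
    (hσ : IsStronglyContinuousLatticeRep σ) {A : Submodule ℝ (Lp ℝ 1 μ)}
    (hA : IsUnitalBoundedSublattice A) (hA' : IsUniformlyContinuousSubspace σ A)
    {D : Set (Lp ℝ 1 μ)} (hDc : D.Countable) (hDA : D ⊆ A) :
    TopologicalSpace.MetrizableSpace
      (LatticeSpectrum (latticeSpan {f | ∃ d ∈ D, ∃ g, σ g d = f})) := by
  set S := {f | ∃ d ∈ D, ∃ g, σ g d = f}
  have hSA : S ⊆ A := by
    rintro _ ⟨d, hd, g, rfl⟩
    exact hA'.map_mem g d (hDA hd)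
  have hB := isUnitalBoundedSublattice_latticeSpan hA hSA
  have := compactSpace_latticeSpectrum hB
  have hS : ∀ (d : D) (g : G), σ g d ∈ latticeSpan S := fun d g =>
    subset_latticeSpan S ⟨d, d.2, g, rfl⟩
  have hcover : ∀ (d : D) (n : ℕ), ∃ t : Set G, t.Countable ∧ ∀ g, ∃ s ∈ t,
      |σ g (d : Lp ℝ 1 μ) - σ s d| ≤ Lp.const 1 μ (1 / ((n : ℝ) + 1)) := by
    intro d n
    obtain ⟨t, ht, hU⟩ := countable_cover_nhds_of_sigmaCompact
      (f := fun s : G => {g | |σ g (d : Lp ℝ 1 μ) - σ s d| ≤ Lp.const 1 μ (1 / ((n : ℝ) + 1))})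
      fun s => hA'.eventually_abs_sub_le hσ (hDA d.2) s (by positivity)
    refine ⟨t, ht, fun g => ?_⟩
    obtain ⟨s, hs, hg⟩ := Set.mem_iUnion₂.1 (hU.symm ▸ Set.mem_univ g : g ∈ ⋃ s ∈ t, _)
    exact ⟨s, hs, hg⟩
  choose t htc ht using hcover
  have := hDc.to_subtype
  have : ∀ d n, Countable (t d n) := fun d n => (htc d n).to_subtype
  let ev : LatticeSpectrum (latticeSpan S) → ((Σ d : D, Σ n : ℕ, t d n) → ℝ) :=
    fun x i => x.1 ⟨σ i.2.2 i.1, hS i.1 i.2.2⟩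
  have hcont : Continuous ev :=
    continuous_pi fun i => (continuous_apply _).comp continuous_subtype_val
  have hinj : Function.Injective ev := by
    intro x y hxy
    refine latticeSpectrum_ext_of_latticeSpan ?_
    rintro _ ⟨d, hd, g, rfl⟩
    refine eq_of_forall_dist_le fun ε hε => ?_
    rw [Real.dist_eq]
    obtain ⟨n, hn⟩ := exists_nat_one_div_lt (half_pos hε)
    obtain ⟨s, hs, hgs⟩ := ht ⟨d, hd⟩ n g
    have h1 := x.2.abs_sub_le hB (f := ⟨σ g d, hS ⟨d, hd⟩ g⟩) (h := ⟨σ s d, hS ⟨d, hd⟩ s⟩) hgs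
    have h2 := y.2.abs_sub_le hB (f := ⟨σ g d, hS ⟨d, hd⟩ g⟩) (h := ⟨σ s d, hS ⟨d, hd⟩ s⟩) hgs
    have h3 : x.1 ⟨σ s d, hS ⟨d, hd⟩ s⟩ = y.1 ⟨σ s d, hS ⟨d, hd⟩ s⟩ :=
      congrFun hxy ⟨⟨d, hd⟩, n, s, hs⟩
    rw [h3] at h1
    rw [abs_le] at h1 h2 ⊢
    constructor <;> linarith [h1.1, h1.2, h2.1, h2.2]
  exact (hcont.isClosedEmbedding hinj).isEmbedding.metrizableSpace

/-- There is a dense invariant sublattice of vectors with uniformly continuous orbits, and it can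
be chosen with metrizable spectrum if `μ` is separable and `G` is `σ`-compact. -/
theorem exists_uniformlyContinuousSubspace [IsTopologicalGroup G] [LocallyCompactSpace G]
    (hσ : IsStronglyContinuousLatticeRep σ) :
    ∃ B : Submodule ℝ (Lp ℝ 1 μ), IsUniformlyContinuousSubspace σ B ∧
      IsUnitalBoundedSublattice B ∧ Dense (B : Set (Lp ℝ 1 μ)) ∧
      (MeasureTheory.IsSeparable μ → SigmaCompactSpace G →
        TopologicalSpace.MetrizableSpace (LatticeSpectrum B)) := by
  have hA := isUnitalBoundedSublattice_uniformlyContinuousVectors hσ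
  have hA' := isUniformlyContinuousSubspace_uniformlyContinuousVectors hσ
  have hd := dense_uniformlyContinuousVectors hσ
  by_cases hsep : MeasureTheory.IsSeparable μ ∧ SigmaCompactSpace G
  · obtain ⟨_, _⟩ := hsep
    have : Fact ((1 : ℝ≥0∞) ≠ ∞) := ⟨ENNReal.one_ne_top⟩
    obtain ⟨D, hDA, hDc, hDd⟩ := hd.exists_countable_dense_subset
    have hSA : {f | ∃ d ∈ D, ∃ g, σ g d = f} ⊆ (uniformlyContinuousVectors σ : Set _) := by
      rintro _ ⟨d, hd, g, rfl⟩
      exact hA'.map_mem g d (hDA hd)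
    refine ⟨_, isUniformlyContinuousSubspace_latticeSpan hσ hA hA' hSA ?_,
      isUnitalBoundedSublattice_latticeSpan hA hSA, hDd.mono fun d hd => ?_,
      fun _ _ => metrizableSpace_latticeSpectrum_latticeSpan hσ hA hA' hDc hDA⟩
    · rintro h _ ⟨d, hd, g, rfl⟩
      refine ⟨d, hd, h * g, ?_⟩
      rw [map_mul, LinearIsometryEquiv.coe_mul, Function.comp_apply]
    · refine subset_latticeSpan _ ⟨d, hd, 1, ?_⟩
      rw [map_one, LinearIsometryEquiv.coe_one, id]
  · exact ⟨_, hA', hA, hd, fun h1 h2 => absurd ⟨h1, h2⟩ hsep⟩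

end Metrizable

end

theorem theorem5p10 {X : Type u} [MeasurableSpace X] (μ : Measure X) [IsProbabilityMeasure μ]
    {G : Type v} [Group G] [TopologicalSpace G] [IsTopologicalGroup G] [LocallyCompactSpace G]
    [T2Space G] (p₀ : FiniteExponent)
    (ρ₀ : G →* (Lp ℝ (p₀ : ℝ≥0∞) μ ≃ₗᵢ[ℝ] Lp ℝ (p₀ : ℝ≥0∞) μ))
    (hρ₀ : IsStronglyContinuousLatticeRep ρ₀) :
    (∃! ρ : ∀ p : FiniteExponent, G →* (Lp ℝ (p : ℝ≥0∞) μ ≃ₗᵢ[ℝ] Lp ℝ (p : ℝ≥0∞) μ),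
      IsNaturalFamily ρ₀ ρ) ∧
    ∀ ρ : ∀ p : FiniteExponent, G →* (Lp ℝ (p : ℝ≥0∞) μ ≃ₗᵢ[ℝ] Lp ℝ (p : ℝ≥0∞) μ),
      IsNaturalFamily ρ₀ ρ →
      ∃ (K : Type u) (_ : TopologicalSpace K) (_ : CompactSpace K) (_ : T2Space K)
        (_ : MulAction G K) (_ : ContinuousSMul G K)
        (_ : MeasurableSpace K) (_ : BorelSpace K)
        (ν : Measure K) (_ : IsProbabilityMeasure ν) (_ : ν.Regular)
        (_ : SMulInvariantMeasure G K ν)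
        (Φ : ∀ p : FiniteExponent, Lp ℝ (p : ℝ≥0∞) μ ≃ₗᵢ[ℝ] Lp ℝ (p : ℝ≥0∞) ν),
        ν.support = Set.univ ∧
        (∀ p : FiniteExponent, PreservesLattice (Φ p)) ∧
        (∀ p : FiniteExponent, Φ p (Lp.const p μ 1) = Lp.const p ν 1) ∧
        (∀ (p q : FiniteExponent) (hpq : (p : ℝ≥0∞) ≤ q) (f : Lp ℝ (q : ℝ≥0∞) μ),
          Φ p (lpInclusion μ hpq f) = lpInclusion ν hpq (Φ q f)) ∧
        (∀ p : FiniteExponent,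
          IsStronglyContinuousLatticeRep (canonicalRep (G := G) ν (p : ℝ≥0∞))) ∧
        (∀ (p : FiniteExponent) (g : G) (f : Lp ℝ (p : ℝ≥0∞) μ),
          Φ p (ρ p g f) = canonicalRep ν (p : ℝ≥0∞) g (Φ p f)) ∧
        (MeasureTheory.IsSeparable μ → SigmaCompactSpace G → TopologicalSpace.MetrizableSpace K) := by
  refine ⟨existsUnique_isNaturalFamily hρ₀, fun ρ hρ => ?_⟩
  have hσ : IsStronglyContinuousLatticeRep (p := 1) (ρ FiniteExponent.one) :=
    hρ.rep FiniteExponent.one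
  obtain ⟨B, hB, hB', hd, hmetr⟩ := exists_uniformlyContinuousSubspace hσ
  obtain ⟨_, _, _, _, _, ν, _, _, _, Φ₁, hsupp, hΦ₁, hequi⟩ :=
    exists_topologicalModel_one hσ hB hB' hd
  obtain ⟨Φ, h1, h2, h3, h4, h5⟩ := exists_equivariant_family hρ rfl hΦ₁ hequi
  exact ⟨LatticeSpectrum B, inferInstance, inferInstance, inferInstance, inferInstance,
    inferInstance, inferInstance, inferInstance, ν, inferInstance, inferInstance, inferInstance, Φ,
    hsupp, h1, h2, h3, h4, h5, hmetr⟩
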